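/- For even $k\ge 2$ and $\operatorname{Im} z>0$ let $$E_k(z)=1+\frac{2}{\zeta(1-k)}\sum_{n\ge1}\Big(\sum_{d\mid n}d^{k-1}\Big)e^{2\pi i n z},\qquad \Delta=\frac{E_4^3-E_6^2}{1728},$$ and let $$\varphi=\frac{(25E_4^4-49E_6^2E_4)+48E_6E_4^2E_2+(-49E_4^3+25E_6^2)E_2^2}{\Delta^2}.$$ For real $r>2$ define $$a(r)=-4\sin(\pi r^2/2)^2\int_0^{i\infty}\varphi\Big(-\frac1z\Big)z^{10}e^{\pi i r^2z}\,dz,$$ where the integral is taken along the positive imaginary axis. This integral converges absolutely for every $r>2$, and the function $r\mapsto a(r)$ continues analytically to a holomorphic function $A$ on a connected open neighborhood of $\mathbb R$ in $\mathbb C$. The restriction of $A$ to $\mathbb R$ is a Schwartz function, and the radial function $x\mapsto A(|x|)$ on $\mathbb R^{24}$ is a Schwartz function that is an eigenfunction with eigenvalue $1$ (so it is not identically zero) of the Fourier transform $\widehat f(y)=\int_{\mathbb R^{24}}f(x)e^{-2\pi i\langle x,y\rangle}\,dx$. -/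

import Mathlib

open scoped FourierTransform SchwartzMap

namespace PlusOneEigenfunction

noncomputable section

/-- The normalized Eisenstein series
`E_k(z) = 1 + (2 / ζ(1 - k)) ∑_{n ≥ 1} (∑_{d ∣ n} d ^ (k - 1)) e ^ (2 π i n z)`
(meaningful for even `k ≥ 2` and `z` in the upper half plane). -/
def eisenstein (k : ℕ) (z : ℂ) : ℂ :=
  1 + 2 / riemannZeta (1 - (k : ℂ)) *
    ∑' n : ℕ+, (∑ d ∈ (n : ℕ).divisors, (d : ℂ) ^ (k - 1)) *
      Complex.exp (2 * Real.pi * Complex.I * (n : ℂ) * z)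

/-- The modular discriminant `Δ = (E₄³ - E₆²) / 1728`. -/
def discr (z : ℂ) : ℂ := (eisenstein 4 z ^ 3 - eisenstein 6 z ^ 2) / 1728

/-- The weakly holomorphic quasimodular form `φ` of weight `-8` and depth `2`. -/
def phi (z : ℂ) : ℂ :=
  ((25 * eisenstein 4 z ^ 4 - 49 * eisenstein 6 z ^ 2 * eisenstein 4 z)
    + 48 * eisenstein 6 z * eisenstein 4 z ^ 2 * eisenstein 2 z
    + (-49 * eisenstein 4 z ^ 3 + 25 * eisenstein 6 z ^ 2) * eisenstein 2 z ^ 2)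
  / discr z ^ 2

/-- The integrand `φ(-1/z) z¹⁰ e^{π i r² z}`. -/
def integrand (r : ℝ) (z : ℂ) : ℂ :=
  phi (-1 / z) * z ^ 10 * Complex.exp (Real.pi * Complex.I * (r : ℂ) ^ 2 * z)

/-- Absolute convergence of the contour integral `∫_0^{i∞} f(z) dz` along the imaginary axis,
parametrized by `z = i t`, `t > 0`. -/
def ConvergesAbsolutely (f : ℂ → ℂ) : Prop :=
  MeasureTheory.IntegrableOn (fun t : ℝ => f (Complex.I * (t : ℂ)) * Complex.I) (Set.Ioi 0)

/-- The contour integral `∫_0^{i∞} f(z) dz` along the imaginary axis,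
parametrized by `z = i t`, `t > 0`, so that `dz = i dt`. -/
def imaginaryAxisIntegral (f : ℂ → ℂ) : ℂ :=
  ∫ t in Set.Ioi (0 : ℝ), f (Complex.I * (t : ℂ)) * Complex.I

/-- `a(r) = -4 sin(π r² / 2)² ∫_0^{i∞} φ(-1/z) z¹⁰ e^{π i r² z} dz`, for real `r > 2`. -/
def a (r : ℝ) : ℂ :=
  -4 * (Real.sin (Real.pi * r ^ 2 / 2) : ℂ) ^ 2 * imaginaryAxisIntegral (integrand r)

end

end PlusOneEigenfunction

set_option autoImplicit false
open Filter Topology Asymptotics Complex Set MeasureTheory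
open scoped Manifold ModularForm MatrixGroups
open UpperHalfPlane hiding I

namespace PlusOneEigenfunction

/-! Since `-4 sin(π r²/2)² = e^{-π i r²} + e^{π i r²} - 2`, the function `a` is a second difference
of contour integrals. Put `phiInv z = φ(-1/z) z¹⁰`. Quasimodularity of `E₂` gives `phiInv z = φ(z)
z² + φ₁(z) z + φ₂(z)` with 1-periodic coefficients (`phi_neg_one_div_mul`), so the second difference
of `phiInv` with step 1 is `2φ` (`phiInv_second_difference`). With `q = e^{2πiz}`, the numerator of
`φ` vanishes to order 3 and `Δ` to order 1, so `φ = O(q)`, while `φ₁ = O(q⁻¹)` and `φ₂ = O(q⁻²)`.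
The last bound is what requires `r > 2`.

For `ε = ±1`, the contour of the term carrying `e^{-π i r² ε}` is moved to an arc from `0` to `ε +
i` followed by a vertical ray (`integral_imaginary_axis_eq`), and then translated by `-ε`. The third
term is split at `i`. Above `i` the three rays combine into an integral of `2φ`, which decays like
`e^{-2πt}`. What remains is the sum of four integrals of `e^{π i r² z}`: over arcs from `∓1` to `i`,
the segment between `0` and `i`, and the ray from `i` to `i∞` (`a_eq`). Each weight decays like
`e^{-2πs}`, so the sum is holomorphic in `u = r²` for `Re u > -1`, and all its derivatives decay
rapidly on `u ≥ 0`. This gives both the continuation and the Schwartz property.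

In dimension 24 the Fourier transform sends `e^{π i |x|² z}` to `(i/z)¹² e^{π i |y|² (-1/z)}`. The
map `z ↦ -1/z` interchanges the two arcs, and interchanges the segment with the ray. The weights
match by periodicity of `φ`, so the sum is fixed (`fourier_arc`, `fourier_axis`, `fourier_invAxis`).

The function is nonzero because `phiInv(it) ~ (864/π²) e^{4πt}`: the integral defining `a` would
have to blow up as `r → 2⁺`, so it cannot vanish identically (`exists_a_ne_zero`). -/

/-! ### Eisenstein series, the discriminant and their transformation laws -/

theorem cexp_two_pi_I_pow (n : ℕ) (z : ℂ) :
    cexp (2 * Real.pi * I * (n : ℂ) * z) = cexp (2 * Real.pi * I * z) ^ n := by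
  rw [← Complex.exp_nat_mul]; ring_nf

theorem eisenstein_add_one (k : ℕ) (z : ℂ) : eisenstein k (z + 1) = eisenstein k z := by
  unfold eisenstein
  congr 2
  refine tsum_congr fun n => ?_
  congr 1
  rw [show 2 * (Real.pi : ℂ) * I * ((n : ℕ) : ℂ) * (z + 1)
    = 2 * Real.pi * I * ((n : ℕ) : ℂ) * z + (n : ℕ) * (2 * Real.pi * I) by ring]
  exact Complex.exp_periodic.nat_mul _ _

theorem riemannZeta_neg_one : riemannZeta (1 - ((2 : ℕ) : ℂ)) = -1 / 12 := by
  have := riemannZeta_neg_nat_eq_bernoulli' 1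
  norm_num [bernoulli'_two] at this ⊢
  exact this

theorem riemannZeta_neg_three : riemannZeta (1 - ((4 : ℕ) : ℂ)) = 1 / 120 := by
  have := riemannZeta_neg_nat_eq_bernoulli' 3
  norm_num [bernoulli'_four] at this ⊢
  exact this

theorem bernoulli'_six : bernoulli' 6 = 1 / 42 := by
  have h5 : bernoulli' 5 = 0 := bernoulli'_eq_zero_of_odd (by decide) (by norm_num)
  rw [bernoulli'_def]
  norm_num [Finset.sum_range_succ, Nat.choose, bernoulli'_two, bernoulli'_three, bernoulli'_four, h5]

theorem riemannZeta_neg_five : riemannZeta (1 - ((6 : ℕ) : ℂ)) = -1 / 252 := by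
  have := riemannZeta_neg_nat_eq_bernoulli' 5
  norm_num [bernoulli'_six] at this ⊢
  exact this

theorem eisenstein_two (z : ℍ) : eisenstein 2 z = EisensteinSeries.E2 z := by
  have h : ∀ n : ℕ+, (∑ d ∈ (n : ℕ).divisors, (d : ℂ) ^ (2 - 1)) *
      cexp (2 * Real.pi * I * (n : ℂ) * z) =
      (ArithmeticFunction.sigma 1 n : ℂ) * cexp (2 * Real.pi * I * z) ^ (n : ℕ) := fun n => by
    rw [cexp_two_pi_I_pow]
    simp [ArithmeticFunction.sigma_apply]
  rw [EisensteinSeries.E2_eq_tsum_cexp, eisenstein, riemannZeta_neg_one, tsum_congr h]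
  norm_num
  rw [sub_eq_add_neg]

theorem eisenstein_eq_E {k : ℕ} (hk : 3 ≤ k) (hk2 : Even k) (z : ℍ) :
    eisenstein k z = ModularForm.E hk z := by
  rw [EisensteinSeries.q_expansion_bernoulli hk hk2, eisenstein, sub_eq_add_neg (1 : ℂ) (_ * _),
    neg_mul_eq_neg_mul]
  obtain ⟨m, rfl⟩ : ∃ m, k = m + 1 := ⟨k - 1, by omega⟩
  have hz : riemannZeta (1 - ((m + 1 : ℕ) : ℂ)) = - bernoulli (m + 1) / (m + 1) := by
    rw [show (1 : ℂ) - ((m + 1 : ℕ) : ℂ) = - (m : ℂ) by push_cast; ring,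
      riemannZeta_neg_nat_eq_bernoulli', bernoulli_eq_bernoulli'_of_ne_one (by omega)]
  rw [hz]
  congr 2
  · push_cast
    rw [div_div_eq_mul_div, div_neg]
  · refine tsum_congr fun n => ?_
    rw [cexp_two_pi_I_pow]
    simp [ArithmeticFunction.sigma_apply]

theorem discr_eq (z : ℍ) : discr z = ModularForm.discriminant z := by
  rw [ModularForm.discriminant_eq_E₄_cube_sub_E₆_sq, discr,
    eisenstein_eq_E (by norm_num) (by decide), eisenstein_eq_E (by norm_num) (by decide)]

theorem discr_ne_zero {z : ℂ} (hz : 0 < z.im) : discr z ≠ 0 := by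
  have := discr_eq ⟨z, hz⟩
  rw [show ((⟨z, hz⟩ : ℍ) : ℂ) = z from rfl] at this
  rw [this]
  exact ModularForm.discriminant_ne_zero _

theorem differentiableOn_of_mdifferentiable {F : ℍ → ℂ} {f : ℂ → ℂ} (hF : MDiff F)
    (h : ∀ z : ℍ, f z = F z) : DifferentiableOn ℂ f {z | 0 < z.im} := by
  rw [UpperHalfPlane.mdifferentiable_iff] at hF
  refine hF.congr fun z hz => ?_
  simpa [ofComplex_apply_of_im_pos hz] using h ⟨z, hz⟩

theorem differentiableOn_eisenstein_two : DifferentiableOn ℂ (eisenstein 2) {z | 0 < z.im} :=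
  differentiableOn_of_mdifferentiable E2_mdifferentiable eisenstein_two

theorem differentiableOn_eisenstein {k : ℕ} (hk : 3 ≤ k) (hk2 : Even k) :
    DifferentiableOn ℂ (eisenstein k) {z | 0 < z.im} :=
  differentiableOn_of_mdifferentiable (ModularForm.E hk).holo' (eisenstein_eq_E hk hk2)

theorem coe_S_smul (z : ℍ) : ((ModularGroup.S • z : ℍ) : ℂ) = -1 / z := by
  rw [UpperHalfPlane.modular_S_smul]
  simp [neg_div]

theorem eisenstein_neg_one_div {k : ℕ} (hk : 3 ≤ k) (hk2 : Even k) {z : ℂ} (hz : 0 < z.im) :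
    eisenstein k (-1 / z) = z ^ k * eisenstein k z := by
  have hz0 : z ≠ 0 := fun h => by simp [h] at hz
  have h1 := eisenstein_eq_E hk hk2 (ModularGroup.S • ⟨z, hz⟩)
  have h2 := eisenstein_eq_E hk hk2 ⟨z, hz⟩
  rw [coe_S_smul] at h1
  have h3 := congrFun ((ModularForm.E hk).slash_action_eq' _
    ⟨ModularGroup.S, rfl⟩) ⟨z, hz⟩
  change ((⇑(ModularForm.E hk)) ∣[(k : ℤ)] ModularGroup.S) _ = _ at h3
  rw [SlashInvariantForm.slash_S_apply, ← UpperHalfPlane.modular_S_smul] at h3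
  change eisenstein k (-1 / z) = _ at h1
  change eisenstein k z = _ at h2
  rw [h1, h2]
  change _ = z ^ k * (ModularForm.E hk) ⟨z, hz⟩
  change _ = (ModularForm.E hk) ⟨z, hz⟩ at h3
  rw [← h3]
  simp
  field_simp

theorem eisenstein_two_neg_one_div {z : ℂ} (hz : 0 < z.im) :
    eisenstein 2 (-1 / z) = z ^ 2 * eisenstein 2 z - 6 * I / Real.pi * z := by
  have hz0 : z ≠ 0 := fun h => by simp [h] at hz
  have hpi : (Real.pi : ℂ) ≠ 0 := by exact_mod_cast Real.pi_ne_zero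
  have h1 := eisenstein_two (ModularGroup.S • ⟨z, hz⟩)
  have h2 := eisenstein_two ⟨z, hz⟩
  rw [coe_S_smul] at h1
  change eisenstein 2 (-1 / z) = _ at h1
  change eisenstein 2 z = _ at h2
  have h3 := congrFun (EisensteinSeries.E2_slash_action ModularGroup.S) ⟨z, hz⟩
  rw [SlashInvariantForm.slash_S_apply, ← UpperHalfPlane.modular_S_smul, ← h1] at h3
  simp only [Pi.sub_apply, Pi.smul_apply, EisensteinSeries.D2_S, smul_eq_mul, riemannZeta_two,
    ← h2] at h3
  change _ * z ^ (-2 : ℤ) = _ - _ * (2 * Real.pi * I / z) at h3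
  rw [zpow_neg, ← div_eq_mul_inv, div_eq_iff (by positivity)] at h3
  rw [h3]
  norm_cast
  push_cast
  field_simp

/-! ### Expansions in the nome up to third order -/

/-- The nome `q = e^{2πiz}`. -/
noncomputable def nome (z : ℂ) : ℂ := cexp (2 * Real.pi * I * z)

theorem norm_nome (z : ℂ) : ‖nome z‖ = Real.exp (-2 * Real.pi * z.im) := by
  simp [nome, Complex.norm_exp]

theorem nome_ne_zero (z : ℂ) : nome z ≠ 0 := Complex.exp_ne_zero _

/-- The closed half plane `Im z ≥ 1/2`. -/
def upperHalf : Set ℂ := {z | 1 / 2 ≤ z.im}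

theorem norm_nome_le {z : ℂ} (hz : z ∈ upperHalf) : ‖nome z‖ ≤ Real.exp (-Real.pi) := by
  rw [norm_nome]
  have : (1 : ℝ) / 2 ≤ z.im := hz
  gcongr
  nlinarith [Real.pi_pos]

theorem norm_nome_le_one {z : ℂ} (hz : z ∈ upperHalf) : ‖nome z‖ ≤ 1 :=
  (norm_nome_le hz).trans (Real.exp_le_one_iff.2 (by linarith [Real.pi_pos]))

theorem nome_pow_isBigO (m n : ℕ) (h : m ≤ n) : (fun z => nome z ^ n) =O[𝓟 upperHalf]
    (fun z => nome z ^ m) := by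
  refine .of_bound 1 (eventually_principal.2 fun z hz => ?_)
  rw [norm_pow, norm_pow, one_mul]
  exact pow_le_pow_of_le_one (norm_nonneg _) (norm_nome_le_one hz) h

theorem const_mul_nome_pow_isBigO (c : ℂ) (m n : ℕ) (h : m ≤ n) :
    (fun z => c * nome z ^ n) =O[𝓟 upperHalf] (fun z => nome z ^ m) :=
  (nome_pow_isBigO m n h).const_mul_left c

/-- `f = a + b q + c q² + O(q³)` uniformly on the half plane `Im z ≥ 1/2`. -/
def HasNomeExpansion (f : ℂ → ℂ) (a b c : ℂ) : Prop :=
  (fun z => f z - (a + b * nome z + c * nome z ^ 2)) =O[𝓟 upperHalf] (fun z => nome z ^ 3)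

namespace HasNomeExpansion

variable {f g : ℂ → ℂ} {a b c a' b' c' : ℂ}

theorem poly_isBigO (a b c : ℂ) : (fun z => a + b * nome z + c * nome z ^ 2)
    =O[𝓟 upperHalf] (fun z => nome z ^ 0) := by
  simpa using (((const_mul_nome_pow_isBigO a 0 0 le_rfl).add
    (const_mul_nome_pow_isBigO b 0 1 (by norm_num))).add
    (const_mul_nome_pow_isBigO c 0 2 (by norm_num)))

theorem isBigO_one (hf : HasNomeExpansion f a b c) :
    f =O[𝓟 upperHalf] (fun z => nome z ^ 0) := by
  simpa using (hf.trans (nome_pow_isBigO 0 3 (by norm_num))).add (poly_isBigO a b c)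

theorem isBigO_nome (hf : HasNomeExpansion f 0 b c) :
    f =O[𝓟 upperHalf] (fun z => nome z ^ 1) := by
  simpa using (hf.trans (nome_pow_isBigO 1 3 (by norm_num))).add
    ((const_mul_nome_pow_isBigO b 1 1 le_rfl).add
    (const_mul_nome_pow_isBigO c 1 2 (by norm_num)))

theorem isBigO_nome_cubed (hf : HasNomeExpansion f 0 0 0) :
    f =O[𝓟 upperHalf] (fun z => nome z ^ 3) := by
  simpa [HasNomeExpansion] using hf

theorem sub_const_isBigO (hf : HasNomeExpansion f a b c) :
    (fun z => f z - a) =O[𝓟 upperHalf] (fun z => nome z ^ 1) := by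
  refine isBigO_nome (b := b) (c := c) (hf.congr_left fun z => ?_)
  ring

theorem add (hf : HasNomeExpansion f a b c) (hg : HasNomeExpansion g a' b' c') :
    HasNomeExpansion (fun z => f z + g z) (a + a') (b + b') (c + c') :=
  (IsBigO.add hf hg).congr_left fun z => by ring

theorem const_mul (hf : HasNomeExpansion f a b c) (k : ℂ) :
    HasNomeExpansion (fun z => k * f z) (k * a) (k * b) (k * c) :=
  (IsBigO.const_mul_left hf k).congr_left fun z => by ring

theorem mul (hf : HasNomeExpansion f a b c) (hg : HasNomeExpansion g a' b' c') :
    HasNomeExpansion (fun z => f z * g z) (a * a') (a * b' + b * a')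
      (a * c' + b * b' + c * a') := by
  have h1 := (IsBigO.mul hf hg.isBigO_one).congr_right (g₂ := fun z => nome z ^ 3) (by simp)
  have h2 := (IsBigO.mul (poly_isBigO a b c) hg).congr_right (g₂ := fun z => nome z ^ 3) (by simp)
  have h3 := ((const_mul_nome_pow_isBigO (b * c' + c * b') 3 3 le_rfl).add
    (const_mul_nome_pow_isBigO (c * c') 3 4 (by norm_num)))
  exact ((h1.add h2).add h3).congr_left fun z => by ring

theorem pow_two (hf : HasNomeExpansion f a b c) :
    HasNomeExpansion (fun z => f z ^ 2) (a * a) (a * b + b * a) (a * c + b * b + c * a) := by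
  simpa only [sq] using hf.mul hf

theorem pow_three (hf : HasNomeExpansion f 1 b c) :
    HasNomeExpansion (fun z => f z ^ 3) 1 (3 * b) (3 * c + 3 * b ^ 2) := by
  have := hf.pow_two.mul hf
  simp only [← pow_succ] at this
  convert this using 1 <;> ring

end HasNomeExpansion

/-- On `Im z ≥ 1/2` one has `|q| ≤ e^{-π}`, so absolute convergence at that radius bounds the tail
divided by `q³` uniformly. -/
theorem hasNomeExpansion_tsum (c : ℕ → ℂ) (hc : Summable fun n => ‖c n‖ * Real.exp (-Real.pi) ^ n) :
    HasNomeExpansion (fun z => ∑' n : ℕ, c n * nome z ^ n) (c 0) (c 1) (c 2) := by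
  refine .of_bound (∑' n, ‖c (n + 3)‖ * Real.exp (-Real.pi) ^ n)
    (eventually_principal.2 fun z hz => ?_)
  have hs3 : Summable fun n => ‖c (n + 3)‖ * Real.exp (-Real.pi) ^ n := by
    have h := ((summable_nat_add_iff 3).2 hc).mul_right ((Real.exp (-Real.pi) ^ 3)⁻¹)
    refine h.congr fun n => ?_
    rw [pow_add, ← mul_assoc, mul_inv_cancel_right₀ (by positivity)]
  have hle : ∀ n, ‖c n * nome z ^ n‖ ≤ ‖c n‖ * Real.exp (-Real.pi) ^ n := fun n => by
    rw [norm_mul, norm_pow]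
    gcongr
    exact norm_nome_le hz
  have hle3 : ∀ n, ‖c (n + 3) * nome z ^ n‖ ≤ ‖c (n + 3)‖ * Real.exp (-Real.pi) ^ n := fun n => by
    rw [norm_mul, norm_pow]
    gcongr
    exact norm_nome_le hz
  have hs : Summable fun n => c n * nome z ^ n := Summable.of_norm_bounded hc hle
  beta_reduce
  rw [← hs.sum_add_tsum_nat_add 3]
  have : (∑ i ∈ Finset.range 3, c i * nome z ^ i) + (∑' n, c (n + 3) * nome z ^ (n + 3))
      - (c 0 + c 1 * nome z + c 2 * nome z ^ 2) = nome z ^ 3 * ∑' n, c (n + 3) * nome z ^ n := by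
    rw [← tsum_mul_left]
    simp only [Finset.sum_range_succ, Finset.sum_range_zero, pow_add]
    rw [show (fun n => c (n + 3) * (nome z ^ n * nome z ^ 3)) =
      fun n => nome z ^ 3 * (c (n + 3) * nome z ^ n) by ext n; ring]
    ring
  rw [this, norm_mul, mul_comm, norm_pow]
  gcongr
  exact tsum_of_norm_bounded hs3.hasSum hle3

theorem hasNomeExpansion_eisenstein (k : ℕ) (hk : 1 ≤ k) :
    HasNomeExpansion (eisenstein k) 1 (2 / riemannZeta (1 - (k : ℂ)))
      (2 / riemannZeta (1 - (k : ℂ)) * (1 + 2 ^ (k - 1))) := by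
  have hs : Summable fun n => ‖(ArithmeticFunction.sigma (k - 1) n : ℂ)‖ *
      Real.exp (-Real.pi) ^ n := by
    -- The point `i/2` is where `|q|` equals `e^{-π}`.
    have := (EisensteinSeries.summable_sigma_mul_cexp_pow hk ⟨I / 2, by simp⟩).norm
    refine this.congr fun n => ?_
    rw [norm_mul, norm_pow]
    congr 2
    have h := norm_nome (I / 2)
    rw [nome] at h
    refine h.trans ?_
    congr 1
    simp
    ring
  have h1 := (hasNomeExpansion_tsum _ hs).const_mul (2 / riemannZeta (1 - (k : ℂ)))
  have h0 : HasNomeExpansion (fun _ => 1) 1 0 0 := by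
    simpa [HasNomeExpansion] using isBigO_zero _ _
  have h2 := h0.add h1
  have hsig : ArithmeticFunction.sigma (k - 1) 2 = 1 + 2 ^ (k - 1) := by
    rw [ArithmeticFunction.sigma_apply, Nat.Prime.divisors Nat.prime_two]
    simp
  simp only [ArithmeticFunction.map_zero, ArithmeticFunction.sigma_one, hsig] at h2
  norm_num at h2
  refine h2.congr_left fun z => ?_
  have h3 : ∑' n : ℕ, (ArithmeticFunction.sigma (k - 1) n : ℂ) * nome z ^ n =
      ∑' n : ℕ+, (∑ d ∈ (n : ℕ).divisors, (d : ℂ) ^ (k - 1)) *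
        cexp (2 * Real.pi * I * (n : ℂ) * z) := by
    -- The sum over positive integers may be taken over all naturals because `σ` is `0` at `0`.
    rw [← PNat.coe_injective.tsum_eq (f := fun n : ℕ =>
      (ArithmeticFunction.sigma (k - 1) n : ℂ) * nome z ^ n)]
    · refine tsum_congr fun n => ?_
      rw [cexp_two_pi_I_pow]
      simp [ArithmeticFunction.sigma_apply, nome]
    · intro n hn
      rcases Nat.eq_zero_or_pos n with rfl | h
      · simp at hn
      · exact ⟨⟨n, h⟩, rfl⟩
  simp only [eisenstein, h3]

theorem hasNomeExpansion_eisenstein_two : HasNomeExpansion (eisenstein 2) 1 (-24) (-72) := by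
  convert hasNomeExpansion_eisenstein 2 (by norm_num) using 1 <;> rw [riemannZeta_neg_one] <;>
    norm_num

theorem hasNomeExpansion_eisenstein_four : HasNomeExpansion (eisenstein 4) 1 240 2160 := by
  convert hasNomeExpansion_eisenstein 4 (by norm_num) using 1 <;> rw [riemannZeta_neg_three] <;>
    norm_num

theorem hasNomeExpansion_eisenstein_six : HasNomeExpansion (eisenstein 6) 1 (-504) (-16632) := by
  convert hasNomeExpansion_eisenstein 6 (by norm_num) using 1 <;> rw [riemannZeta_neg_five] <;>
    norm_num

theorem hasNomeExpansion_discr : HasNomeExpansion discr 0 1 (-24) := by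
  have h := ((hasNomeExpansion_eisenstein_four.pow_three).add
    ((hasNomeExpansion_eisenstein_six.pow_two).const_mul (-1))).const_mul (1 / 1728)
  norm_num at h
  refine h.congr_left fun z => ?_
  rw [discr]
  ring

/-! ### The numerator of `φ` as a polynomial in `E₂`, and growth at the cusp -/

/-- The coefficient of `E₂²` in the numerator of `φ`. -/
noncomputable def phiNumQuad (z : ℂ) : ℂ := -49 * eisenstein 4 z ^ 3 + 25 * eisenstein 6 z ^ 2

/-- The derivative of the numerator of `φ` with respect to `E₂`. -/
noncomputable def phiNumDeriv (z : ℂ) : ℂ :=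
  48 * eisenstein 6 z * eisenstein 4 z ^ 2 + 2 * phiNumQuad z * eisenstein 2 z

/-- The numerator of `φ`. -/
noncomputable def phiNum (z : ℂ) : ℂ :=
  (25 * eisenstein 4 z ^ 4 - 49 * eisenstein 6 z ^ 2 * eisenstein 4 z)
    + 48 * eisenstein 6 z * eisenstein 4 z ^ 2 * eisenstein 2 z
    + phiNumQuad z * eisenstein 2 z ^ 2

theorem phi_eq (z : ℂ) : phi z = phiNum z / discr z ^ 2 := rfl

theorem hasNomeExpansion_phiNumQuad : HasNomeExpansion phiNumQuad (-24) (-60480) (-3265920) := by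
  have h := ((hasNomeExpansion_eisenstein_four.pow_three).const_mul (-49)).add
    ((hasNomeExpansion_eisenstein_six.pow_two).const_mul 25)
  norm_num at h
  exact h.congr_left fun z => by rw [phiNumQuad]; ring

theorem hasNomeExpansion_phiNumDeriv :
    HasNomeExpansion phiNumDeriv 0 (-120960) (-13063680) := by
  have h := ((hasNomeExpansion_eisenstein_six.mul hasNomeExpansion_eisenstein_four.pow_two).const_mul
    48).add ((hasNomeExpansion_phiNumQuad.mul hasNomeExpansion_eisenstein_two).const_mul 2)
  norm_num at h
  refine h.congr_left fun z => ?_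
  rw [phiNumDeriv]
  ring

/-- This is where the coefficients 25, 49, 48 matter: they cancel the terms in `1`, `q` and `q²`, so
that `φ` still vanishes at the cusp after division by `Δ² ~ q²`. -/
theorem hasNomeExpansion_phiNum : HasNomeExpansion phiNum 0 0 0 := by
  have h4 := hasNomeExpansion_eisenstein_four
  have h6 := hasNomeExpansion_eisenstein_six
  have h2 := hasNomeExpansion_eisenstein_two
  have h := (((h4.pow_two.pow_two.const_mul 25).add ((h6.pow_two.mul h4).const_mul (-49))).add
    (((h6.mul h4.pow_two).mul h2).const_mul 48)).add (hasNomeExpansion_phiNumQuad.mul h2.pow_two)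
  norm_num at h
  refine h.congr_left fun z => ?_
  rw [phiNum]
  ring

/-- For `q ≠ 0` the product is a factor of `Δ` at a point of the upper half plane, where `Δ` does
not vanish. -/
theorem tprod_one_sub_pow_ne_zero {q : ℂ} (hq : ‖q‖ < 1) :
    ∏' i : ℕ, (1 - q ^ (i + 1)) ^ 24 ≠ 0 := by
  rcases eq_or_ne q 0 with rfl | hq0
  · simp
  have him := Function.Periodic.im_invQParam_pos_of_norm_lt_one one_pos hq hq0
  have h := ModularForm.discriminant_eq_q_prod ⟨_, him⟩
  have hne := ModularForm.discriminant_ne_zero ⟨_, him⟩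
  rw [h] at hne
  have := right_ne_zero_of_mul hne
  simpa [ModularForm.eta_q, Function.Periodic.qParam_right_inv one_ne_zero hq0] using this

theorem discr_eq_nome_mul_tprod {z : ℂ} (hz : 0 < z.im) :
    discr z = nome z * ∏' i : ℕ, (1 - nome z ^ (i + 1)) ^ 24 := by
  have h := discr_eq ⟨z, hz⟩
  rw [ModularForm.discriminant_eq_q_prod] at h
  change discr z = _ at h
  rw [h]
  simp [Function.Periodic.qParam, ModularForm.eta_q, nome]

/-- The quotient `Δ/q` is a continuous nonvanishing function of `q` on the compact disc `|q| ≤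
e^{-π}`, hence bounded below in modulus. -/
theorem nome_isBigO_discr : nome =O[𝓟 upperHalf] discr := by
  have hr : Real.exp (-Real.pi) < 1 := Real.exp_lt_one_iff.2 (by linarith [Real.pi_pos])
  have hcont : ContinuousOn (fun q : ℂ => ∏' i : ℕ, (1 - q ^ (i + 1)) ^ 24)
      (Metric.closedBall 0 (Real.exp (-Real.pi))) :=
    (ModularForm.differentiableOn_tprod_one_sub_pow_pow 24).continuousOn.mono
      (Metric.closedBall_subset_ball hr)
  obtain ⟨q₀, hq₀, hmin⟩ := (isCompact_closedBall (0 : ℂ) (Real.exp (-Real.pi))).exists_isMinOn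
    ⟨0, by simp [(Real.exp_pos _).le]⟩ hcont.norm
  have hpos : 0 < ‖∏' i : ℕ, (1 - q₀ ^ (i + 1)) ^ 24‖ :=
    norm_pos_iff.2 (tprod_one_sub_pow_ne_zero ((mem_closedBall_zero_iff.1 hq₀).trans_lt hr))
  refine .of_bound (‖∏' i : ℕ, (1 - q₀ ^ (i + 1)) ^ 24‖⁻¹)
    (eventually_principal.2 fun z hz => ?_)
  have hz0 : 0 < z.im := lt_of_lt_of_le (by norm_num) hz
  have h : ‖∏' i : ℕ, (1 - q₀ ^ (i + 1)) ^ 24‖ ≤ ‖∏' i : ℕ, (1 - nome z ^ (i + 1)) ^ 24‖ :=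
    hmin (mem_closedBall_zero_iff.2 (norm_nome_le hz))
  rw [discr_eq_nome_mul_tprod hz0, norm_mul, inv_mul_eq_div, le_div_iff₀ hpos]
  gcongr

theorem discr_sq_inv_isBigO :
    (fun z => (discr z ^ 2)⁻¹) =O[𝓟 upperHalf] (fun z => (nome z ^ 2)⁻¹) :=
  (nome_isBigO_discr.pow 2).inv_rev (Eventually.of_forall fun z h =>
    absurd h (pow_ne_zero 2 (nome_ne_zero z)))

/-- The coefficient of `z` in `z ^ 10 * φ (-1 / z)`. -/
noncomputable def phiOne (z : ℂ) : ℂ := -(6 * I / Real.pi) * (phiNumDeriv z / discr z ^ 2)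

/-- The constant coefficient of `z ^ 10 * φ (-1 / z)`. -/
noncomputable def phiTwo (z : ℂ) : ℂ := (6 * I / Real.pi) ^ 2 * (phiNumQuad z / discr z ^ 2)

theorem discr_neg_one_div {z : ℂ} (hz : 0 < z.im) : discr (-1 / z) = z ^ 12 * discr z := by
  rw [discr, discr, eisenstein_neg_one_div (by norm_num) (by decide) hz,
    eisenstein_neg_one_div (by norm_num) (by decide) hz]
  ring

/-- The numerator is quadratic in `E₂`, and `z ↦ -1/z` shifts `E₂` by `-(6i/π)/z` up to the weight
factor. The Taylor expansion in `E₂` is therefore exact after two derivatives, and the weights 16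
and 24 leave powers of `z` that `z¹⁰` turns into a polynomial. -/
theorem phi_neg_one_div_mul {z : ℂ} (hz : 0 < z.im) :
    phi (-1 / z) * z ^ 10 = phi z * z ^ 2 + phiOne z * z + phiTwo z := by
  have hz0 : z ≠ 0 := fun h => by simp [h] at hz
  have hd := discr_ne_zero hz
  rw [phi_eq, phi_eq, phiOne, phiTwo, discr_neg_one_div hz]
  have hnum : phiNum (-1 / z) = z ^ 14 * (z ^ 2 * phiNum z - (6 * I / Real.pi) * z * phiNumDeriv z
      + (6 * I / Real.pi) ^ 2 * phiNumQuad z) := by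
    simp only [phiNum, phiNumDeriv, phiNumQuad]
    rw [eisenstein_neg_one_div (by norm_num) (by decide) hz,
      eisenstein_neg_one_div (by norm_num) (by decide) hz, eisenstein_two_neg_one_div hz]
    ring
  rw [hnum]
  field_simp
  ring

theorem discr_add_one (z : ℂ) : discr (z + 1) = discr z := by
  simp only [discr, eisenstein_add_one]

theorem phi_add_one (z : ℂ) : phi (z + 1) = phi z := by
  simp only [phi, discr_add_one, eisenstein_add_one]

theorem phiOne_add_one (z : ℂ) : phiOne (z + 1) = phiOne z := by
  simp only [phiOne, phiNumDeriv, phiNumQuad, discr_add_one, eisenstein_add_one]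

theorem phiTwo_add_one (z : ℂ) : phiTwo (z + 1) = phiTwo z := by
  simp only [phiTwo, phiNumQuad, discr_add_one, eisenstein_add_one]

theorem exists_norm_le_of_isBigO {f g : ℂ → ℂ} (h : f =O[𝓟 upperHalf] g) :
    ∃ C, 0 ≤ C ∧ ∀ z : ℂ, 1 / 2 ≤ z.im → ‖f z‖ ≤ C * ‖g z‖ := by
  obtain ⟨C, hC0, hC⟩ := h.exists_nonneg
  exact ⟨C, hC0, fun z hz => eventually_principal.1 hC.bound z hz⟩

theorem exists_norm_phi_le :
    ∃ C, 0 ≤ C ∧ ∀ z : ℂ, 1 / 2 ≤ z.im → ‖phi z‖ ≤ C * Real.exp (-2 * Real.pi * z.im) := by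
  have h := (hasNomeExpansion_phiNum.isBigO_nome_cubed.mul discr_sq_inv_isBigO).congr
    (f₂ := phi) (g₂ := nome) (fun z => by rw [phi_eq, div_eq_mul_inv])
    (fun z => by have := nome_ne_zero z; field_simp)
  simpa only [norm_nome] using exists_norm_le_of_isBigO h

theorem exists_norm_phiOne_le :
    ∃ C, 0 ≤ C ∧ ∀ z : ℂ, 1 / 2 ≤ z.im → ‖phiOne z‖ ≤ C * Real.exp (2 * Real.pi * z.im) := by
  have h := ((hasNomeExpansion_phiNumDeriv.isBigO_nome.mul discr_sq_inv_isBigO).const_mul_left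
    (-(6 * I / Real.pi))).congr
    (f₂ := phiOne) (g₂ := fun z => (nome z)⁻¹) (fun z => by rw [phiOne, div_eq_mul_inv (phiNumDeriv z)])
    (fun z => by have := nome_ne_zero z; field_simp)
  obtain ⟨C, h0, h⟩ := exists_norm_le_of_isBigO h
  refine ⟨C, h0, fun z hz => (h z hz).trans_eq ?_⟩
  rw [norm_inv, norm_nome, ← Real.exp_neg]
  ring_nf

theorem exists_norm_phiTwo_le :
    ∃ C, 0 ≤ C ∧ ∀ z : ℂ, 1 / 2 ≤ z.im → ‖phiTwo z‖ ≤ C * Real.exp (4 * Real.pi * z.im) := by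
  have h := ((hasNomeExpansion_phiNumQuad.isBigO_one.mul discr_sq_inv_isBigO).const_mul_left
    ((6 * I / Real.pi) ^ 2)).congr
    (f₂ := phiTwo) (g₂ := fun z => (nome z ^ 2)⁻¹) (fun z => by rw [phiTwo, div_eq_mul_inv (phiNumQuad z)])
    (fun z => by simp)
  obtain ⟨C, h0, h⟩ := exists_norm_le_of_isBigO h
  refine ⟨C, h0, fun z hz => (h z hz).trans_eq ?_⟩
  rw [norm_inv, norm_pow, norm_nome, ← Real.exp_nat_mul, ← Real.exp_neg]
  push_cast
  ring_nf

theorem tendsto_nome_imaginary_axis : Tendsto (fun t : ℝ => nome (I * t)) atTop (𝓝 0) := by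
  rw [tendsto_zero_iff_norm_tendsto_zero]
  simp only [norm_nome]
  have : Tendsto (fun t : ℝ => 2 * Real.pi * t) atTop atTop :=
    tendsto_id.const_mul_atTop (by positivity)
  refine (Real.tendsto_exp_neg_atTop_nhds_zero.comp this).congr fun t => ?_
  simp

/-- The limit is `(6i/π)² · (-24)`, where `-24` is the constant term of `phiNumQuad`, since `Δ/q →
1`. -/
theorem tendsto_phiTwo_mul_nome_sq :
    Tendsto (fun t : ℝ => phiTwo (I * t) * nome (I * t) ^ 2) atTop
      (𝓝 ((864 / Real.pi ^ 2 : ℝ) : ℂ)) := by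
  have hup : Tendsto (fun t : ℝ => I * (t : ℂ)) atTop (𝓟 upperHalf) := by
    rw [tendsto_principal]
    filter_upwards [eventually_ge_atTop (1 / 2)] with t ht
    simpa [upperHalf] using ht
  have h1 : Tendsto (fun t : ℝ => phiNumQuad (I * t)) atTop (𝓝 (-24)) := by
    have := (hasNomeExpansion_phiNumQuad.sub_const_isBigO.comp_tendsto hup).trans_tendsto
      (by simpa [Function.comp_def] using tendsto_nome_imaginary_axis)
    simpa using this.add_const (-24)
  have h2 : Tendsto (fun t : ℝ => discr (I * t) / nome (I * t)) atTop (𝓝 1) := by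
    have hd : (fun z => discr z - nome z) =O[𝓟 upperHalf] (fun z => nome z ^ 2) := by
      have := (hasNomeExpansion_discr.trans (nome_pow_isBigO 2 3 (by norm_num))).add
        (const_mul_nome_pow_isBigO (-24) 2 2 le_rfl)
      exact this.congr_left fun z => by ring
    have hd' := (hd.mul (isBigO_refl (fun z => (nome z)⁻¹) _)).congr_right (g₂ := nome) fun z => by
      have := nome_ne_zero z
      field_simp
    have := (hd'.comp_tendsto hup).trans_tendsto tendsto_nome_imaginary_axis
    refine (by simpa using this.add_const 1 : Tendsto _ _ (𝓝 (1 : ℂ))).congr fun t => ?_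
    have := nome_ne_zero (I * t)
    field_simp
    ring
  have h3 := (h1.div (h2.pow 2) (by norm_num)).const_mul ((6 * I / Real.pi) ^ 2)
  convert h3 using 2 with t
  · have := nome_ne_zero (I * t)
    simp only [phiTwo, Pi.div_apply]
    field_simp
  · push_cast
    rw [div_pow, mul_pow, I_sq]
    ring

theorem differentiableOn_phi : DifferentiableOn ℂ phi {z | 0 < z.im} := by
  have h2 := differentiableOn_eisenstein_two
  have h4 := differentiableOn_eisenstein (k := 4) (by norm_num) (by decide)
  have h6 := differentiableOn_eisenstein (k := 6) (by norm_num) (by decide)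
  unfold phi
  refine DifferentiableOn.div (by fun_prop) ?_ fun z hz => pow_ne_zero 2 (discr_ne_zero hz)
  unfold discr
  fun_prop

/-! ### Schwartz functions of the squared norm -/

section Radial

variable {E : Type*} [NormedAddCommGroup E] [InnerProductSpace ℝ E]

theorem iteratedDerivWithin_of_hasDerivAt {G : ℕ → ℝ → ℂ} {S : Set ℝ} (hS : IsOpen S)
    (hG : ∀ n, ∀ u ∈ S, HasDerivAt (G n) (G (n + 1) u) u) (n : ℕ) {u : ℝ} (hu : u ∈ S) :
    iteratedDerivWithin n (G 0) S u = G n u := by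
  induction n generalizing u with
  | zero => simp
  | succ n ih =>
    rw [iteratedDerivWithin_succ, derivWithin_congr (fun x hx => ih hx) (ih hu),
      (hG n u hu).hasDerivWithinAt.derivWithin (hS.uniqueDiffWithinAt hu)]

theorem contDiffOn_of_hasDerivAt {G : ℕ → ℝ → ℂ} {S : Set ℝ} (hS : IsOpen S)
    (hG : ∀ n, ∀ u ∈ S, HasDerivAt (G n) (G (n + 1) u) u) :
    ContDiffOn ℝ (⊤ : ℕ∞) (G 0) S := by
  refine contDiffOn_of_differentiableOn_deriv fun m _ => ?_
  exact DifferentiableOn.congr (fun u hu => (hG m u hu).differentiableAt.differentiableWithinAt)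
    fun u hu => iteratedDerivWithin_of_hasDerivAt hS hG m hu

theorem one_add_pow_le {u : ℝ} (hu : 0 ≤ u) (k : ℕ) : (1 + u) ^ k ≤ 2 ^ k * (1 + u ^ k) := by
  rcases le_total u 1 with h | h
  · calc (1 + u) ^ k ≤ 2 ^ k := by gcongr; linarith
      _ ≤ 2 ^ k * (1 + u ^ k) := le_mul_of_one_le_right (by positivity) (by simp; positivity)
  · calc (1 + u) ^ k ≤ (2 * u) ^ k := by gcongr; linarith
      _ = 2 ^ k * u ^ k := mul_pow _ _ _
      _ ≤ 2 ^ k * (1 + u ^ k) := by gcongr; linarith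

/-- A function of `‖x‖²` all of whose derivatives decay rapidly is a Schwartz function. -/
theorem exists_schwartz_comp_norm_sq (G : ℕ → ℝ → ℂ)
    (hG : ∀ n, ∀ u ∈ Ioi (-1 : ℝ), HasDerivAt (G n) (G (n + 1) u) u)
    (hdec : ∀ k n : ℕ, ∃ M, ∀ u : ℝ, 0 ≤ u → u ^ k * ‖G n u‖ ≤ M) :
    ∃ f : 𝓢(E, ℂ), ∀ x, f x = G 0 (‖x‖ ^ 2) := by
  have hcd := contDiffOn_of_hasDerivAt isOpen_Ioi hG
  have hsq : ContDiff ℝ (⊤ : ℕ∞) (fun x : E => ‖x‖ ^ 2) := contDiff_norm_sq ℝ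
  -- Working on an open set containing `[0, ∞)` keeps the derivatives at `0` two-sided.
  have hrange : range (fun x : E => ‖x‖ ^ 2) ⊆ Ioi (-1 : ℝ) := by
    rintro _ ⟨x, rfl⟩
    exact lt_of_lt_of_le (by norm_num) (sq_nonneg ‖x‖)
  have hdec' : ∀ k n : ℕ, ∃ M, ∀ x : E, (1 + ‖x‖) ^ k * ‖G n (‖x‖ ^ 2)‖ ≤ M := fun k n => by
    obtain ⟨M₀, h₀⟩ := hdec 0 n
    obtain ⟨M₁, h₁⟩ := hdec k n
    refine ⟨2 ^ k * (2 ^ k * (M₀ + M₁)), fun x => ?_⟩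
    have hu : 0 ≤ ‖x‖ ^ 2 := sq_nonneg _
    calc (1 + ‖x‖) ^ k * ‖G n (‖x‖ ^ 2)‖
        ≤ (2 * (1 + ‖x‖ ^ 2)) ^ k * ‖G n (‖x‖ ^ 2)‖ := by
          gcongr
          nlinarith [sq_nonneg (‖x‖ - 1)]
      _ ≤ 2 ^ k * (2 ^ k * (1 + (‖x‖ ^ 2) ^ k)) * ‖G n (‖x‖ ^ 2)‖ := by
          rw [mul_pow]
          gcongr
          exact one_add_pow_le hu k
      _ = 2 ^ k * (2 ^ k * ((‖x‖ ^ 2) ^ 0 * ‖G n (‖x‖ ^ 2)‖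
          + (‖x‖ ^ 2) ^ k * ‖G n (‖x‖ ^ 2)‖)) := by ring
      _ ≤ _ := by
          gcongr
          exacts [h₀ _ hu, h₁ _ hu]
  refine ⟨⟨fun x => G 0 (‖x‖ ^ 2), ?_, fun k n => ?_⟩, fun x => rfl⟩
  · have := hcd.comp_contDiff hsq fun x => hrange ⟨x, rfl⟩
    exact this
  · obtain ⟨l, C, hC, hbound⟩ :=
      (Function.hasTemperateGrowth_norm_sq (H := E)).norm_iteratedFDeriv_le_uniform n
    choose M hM using fun i => hdec' (k + l * n) i
    refine ⟨n.factorial * (1 + C) ^ n * ∑ i ∈ Finset.range (n + 1), M i, fun x => ?_⟩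
    -- The Faà di Bruno estimate needs the `i`-th derivative of the inner map bounded by `D ^ i`; as
    -- `D ≥ 1`, the uniform bound `D` suffices for `i ≥ 1`.
    have hone : 1 ≤ (1 + C) * (1 + ‖x‖) ^ l :=
      one_le_mul_of_one_le_of_one_le (by linarith) (one_le_pow₀ (by linarith [norm_nonneg x]))
    have key := norm_iteratedFDeriv_comp_le' (𝕜 := ℝ) hrange isOpen_Ioi.uniqueDiffOn hcd hsq
      (n := n) (by exact_mod_cast le_top) x
      (C := ∑ i ∈ Finset.range (n + 1), ‖G i (‖x‖ ^ 2)‖) (D := (1 + C) * (1 + ‖x‖) ^ l)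
      (fun i hi => by
        rw [norm_iteratedFDerivWithin_eq_norm_iteratedDerivWithin,
          iteratedDerivWithin_of_hasDerivAt isOpen_Ioi hG i (hrange ⟨x, rfl⟩)]
        exact Finset.single_le_sum (f := fun i => ‖G i (‖x‖ ^ 2)‖) (fun _ _ => norm_nonneg _)
          (Finset.mem_range.2 (by omega)))
      (fun i hi hin => by
        refine (hbound i hin x).trans (le_trans ?_ (le_self_pow₀ hone (by omega)))
        gcongr
        linarith)
    calc ‖x‖ ^ k * ‖iteratedFDeriv ℝ n (fun x => G 0 (‖x‖ ^ 2)) x‖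
        ≤ (1 + ‖x‖) ^ k * (n.factorial * (∑ i ∈ Finset.range (n + 1), ‖G i (‖x‖ ^ 2)‖) *
          ((1 + C) * (1 + ‖x‖) ^ l) ^ n) := by
          gcongr
          · linarith
          · exact key
      _ = n.factorial * (1 + C) ^ n * ∑ i ∈ Finset.range (n + 1),
          (1 + ‖x‖) ^ (k + l * n) * ‖G i (‖x‖ ^ 2)‖ := by
          rw [← Finset.mul_sum, mul_pow, ← pow_mul, pow_add]
          ring
      _ ≤ _ := by
          gcongr with i
          exact hM i x

end Radial

/-! ### Superpositions of Gaussians -/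

/-- Weights `c` and parameters `z` in the upper half plane, indexed by `s > a`, such that the
superposition `∫ c(s) exp(π i u z(s)) ds` of Gaussians (as a function of `u = |x|²`) converges
together with all its derivatives. -/
structure IsGaussianPath (a : ℝ) (c z : ℝ → ℂ) : Prop where
  nonneg : 0 ≤ a
  continuousOn_weight : ContinuousOn c (Ioi a)
  continuousOn_path : ContinuousOn z (Ioi a)
  exists_norm_weight_le : ∃ C, 0 ≤ C ∧ ∀ s, a < s → ‖c s‖ ≤ C * Real.exp (-2 * Real.pi * s)
  abs_re_le : ∀ s, a < s → |(z s).re| ≤ 1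
  inv_le_im : ∀ s, a < s → (s + 1)⁻¹ ≤ (z s).im
  im_le : ∀ s, a < s → (z s).im ≤ s + 1

/-- The `n`-th derivative in `u` of the superposition of Gaussians `∫ c(s) exp(π i u z(s)) ds`. -/
noncomputable def superposition (a : ℝ) (c z : ℝ → ℂ) (n : ℕ) (u : ℂ) : ℂ :=
  ∫ s in Ioi a, c s * (Real.pi * I * z s) ^ n * cexp (Real.pi * I * u * z s)

namespace IsGaussianPath

variable {a : ℝ} {c z : ℝ → ℂ}

theorem im_pos (h : IsGaussianPath a c z) {s : ℝ} (hs : a < s) : 0 < (z s).im := by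
  have hs1 : 0 < s + 1 := by linarith [h.nonneg]
  exact (inv_pos.2 hs1).trans_le (h.inv_le_im s hs)

theorem norm_pow_le (h : IsGaussianPath a c z) (n : ℕ) {s : ℝ} (hs : a < s) :
    ‖(Real.pi * I * z s) ^ n‖ ≤ Real.pi ^ n * (s + 2) ^ n := by
  have h1 : ‖z s‖ ≤ s + 2 := by
    have := Complex.norm_le_abs_re_add_abs_im (z s)
    rw [abs_of_pos (h.im_pos hs)] at this
    linarith [h.abs_re_le s hs, h.im_le s hs]
  rw [norm_pow, norm_mul, norm_mul, norm_I, mul_one, Complex.norm_real, Real.norm_of_nonneg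
    Real.pi_pos.le, mul_pow]
  gcongr

theorem norm_exp_le (h : IsGaussianPath a c z) {u : ℂ} (hu : -1 < u.re) {s : ℝ} (hs : a < s) :
    ‖cexp (Real.pi * I * u * z s)‖ ≤ Real.exp (Real.pi * (s + 1 + |u.im|)) := by
  rw [Complex.norm_exp]
  have h1 : (Real.pi * I * u * z s).re = Real.pi * (-(u.re * (z s).im) - u.im * (z s).re) := by
    simp
    ring
  rw [h1]
  gcongr
  have h2 : -(u.im * (z s).re) ≤ |u.im| := by
    refine (neg_le_abs _).trans ?_
    rw [abs_mul]
    exact mul_le_of_le_one_right (abs_nonneg _) (h.abs_re_le s hs)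
  nlinarith [h.im_pos hs, h.im_le s hs]

theorem add_two_pow_le {s : ℝ} (hs : 0 ≤ s) (n : ℕ) :
    (s + 2) ^ n ≤ n.factorial * Real.exp (s + 2) := by
  have := Real.pow_div_factorial_le_exp (s + 2) (by linarith) n
  rwa [div_le_iff₀ (by positivity), mul_comm] at this

/-- The weight contributes `e^{-2πs}`, the exponential at most `e^{πs}` since `Re u > -1` and `Im z
≤ s + 1`, and the polynomial factor at most `n! e^{s+2}`; what is left is `e^{-(π-1)s}`. -/
theorem exists_norm_integrand_le (h : IsGaussianPath a c z) (n : ℕ) (M : ℝ) :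
    ∃ K, ∀ u : ℂ, -1 < u.re → |u.im| ≤ M → ∀ s, a < s →
      ‖c s * (Real.pi * I * z s) ^ n * cexp (Real.pi * I * u * z s)‖ ≤
        K * Real.exp (-(Real.pi - 1) * s) := by
  obtain ⟨C, hC0, hC⟩ := h.exists_norm_weight_le
  refine ⟨C * Real.pi ^ n * n.factorial * Real.exp (2 + Real.pi * (1 + M)),
    fun u hu hM s hs => ?_⟩
  have hs0 : 0 ≤ s := h.nonneg.trans hs.le
  rw [norm_mul, norm_mul]
  calc ‖c s‖ * ‖(Real.pi * I * z s) ^ n‖ * ‖cexp (Real.pi * I * u * z s)‖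
      ≤ (C * Real.exp (-2 * Real.pi * s)) * (Real.pi ^ n * (n.factorial * Real.exp (s + 2))) *
        Real.exp (Real.pi * (s + 1 + M)) := by
        gcongr
        · exact hC s hs
        · refine (h.norm_pow_le n hs).trans ?_
          gcongr
          exact add_two_pow_le hs0 n
        · refine (h.norm_exp_le hu hs).trans ?_
          gcongr
    _ = C * Real.pi ^ n * n.factorial *
        (Real.exp (-2 * Real.pi * s) * Real.exp (s + 2) * Real.exp (Real.pi * (s + 1 + M))) := by
        ring
    _ = C * Real.pi ^ n * n.factorial * (Real.exp (2 + Real.pi * (1 + M)) *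
        Real.exp (-(Real.pi - 1) * s)) := by
        rw [← Real.exp_add, ← Real.exp_add, ← Real.exp_add]
        ring_nf
    _ = _ := by ring

theorem integrableOn_exp (a : ℝ) : IntegrableOn (fun s => Real.exp (-(Real.pi - 1) * s)) (Ioi a) :=
  exp_neg_integrableOn_Ioi a (by linarith [Real.pi_gt_three])

theorem aestronglyMeasurable (h : IsGaussianPath a c z) (n : ℕ) (u : ℂ) :
    AEStronglyMeasurable (fun s => c s * (Real.pi * I * z s) ^ n * cexp (Real.pi * I * u * z s))
      (volume.restrict (Ioi a)) := by
  have h1 := h.continuousOn_weight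
  have h2 := h.continuousOn_path
  exact ContinuousOn.aestronglyMeasurable (by fun_prop) measurableSet_Ioi

theorem integrableOn (h : IsGaussianPath a c z) (n : ℕ) {u : ℂ} (hu : -1 < u.re) :
    IntegrableOn (fun s => c s * (Real.pi * I * z s) ^ n * cexp (Real.pi * I * u * z s))
      (Ioi a) := by
  obtain ⟨K, hK⟩ := h.exists_norm_integrand_le n |u.im|
  refine Integrable.mono' ((integrableOn_exp a).const_mul K) (h.aestronglyMeasurable n u) ?_
  exact (ae_restrict_iff' measurableSet_Ioi).2 (.of_forall fun s hs => hK u hu le_rfl s hs)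

theorem hasDerivAt (h : IsGaussianPath a c z) (n : ℕ) {u : ℂ} (hu : -1 < u.re) :
    HasDerivAt (superposition a c z n) (superposition a c z (n + 1) u) u := by
  obtain ⟨K, hK⟩ := h.exists_norm_integrand_le (n + 1) (|u.im| + 1)
  have hnhds : {v : ℂ | -1 < v.re ∧ |v.im| < |u.im| + 1} ∈ 𝓝 u :=
    ((isOpen_lt continuous_const Complex.continuous_re).inter
      (isOpen_lt Complex.continuous_im.abs continuous_const)).mem_nhds ⟨hu, by simp⟩
  refine (hasDerivAt_integral_of_dominated_loc_of_deriv_le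
    (F' := fun v s => c s * (Real.pi * I * z s) ^ (n + 1) * cexp (Real.pi * I * v * z s)) hnhds
    (.of_forall fun v => h.aestronglyMeasurable n v) (h.integrableOn n hu)
    (h.aestronglyMeasurable (n + 1) u) (bound := fun s => K * Real.exp (-(Real.pi - 1) * s)) ?_
    ((integrableOn_exp a).const_mul K) ?_).2
  · exact (ae_restrict_iff' measurableSet_Ioi).2
      (.of_forall fun s hs v hv => hK v hv.1 hv.2.le s hs)
  · refine .of_forall fun s v _ => ?_
    have h1 : HasDerivAt (fun v : ℂ => Real.pi * I * v * z s) (Real.pi * I * z s) v := by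
      simpa using ((hasDerivAt_id v).const_mul (Real.pi * I)).mul_const (z s)
    refine (h1.cexp.const_mul (c s * (Real.pi * I * z s) ^ n)).congr_deriv ?_
    ring

theorem hasDerivAt_ofReal (h : IsGaussianPath a c z) (n : ℕ) {u : ℝ} (hu : u ∈ Ioi (-1 : ℝ)) :
    HasDerivAt (fun u : ℝ => superposition a c z n u) (superposition a c z (n + 1) u) u :=
  (h.hasDerivAt n (u := u) (by simpa using hu)).comp_ofReal

/-- The Gaussian may become flat as `s → ∞`, but only at rate `Im z ≥ 1/(s+1)`. Hence `u^k` costs at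
most `k! (s+1)^k`, which the exponentially small weight absorbs. -/
theorem exists_pow_mul_norm_le (h : IsGaussianPath a c z) (k n : ℕ) :
    ∃ M, ∀ u : ℝ, 0 ≤ u → u ^ k * ‖superposition a c z n u‖ ≤ M := by
  obtain ⟨C, hC0, hC⟩ := h.exists_norm_weight_le
  refine ⟨∫ s in Ioi a, C * Real.pi ^ n * k.factorial * (n + k).factorial * Real.exp 2 *
    Real.exp (-(Real.pi - 1) * s), fun u hu => ?_⟩
  have hu' : u ^ k * ‖superposition a c z n u‖ = ‖∫ s in Ioi a, (u : ℂ) ^ k *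
      (c s * (Real.pi * I * z s) ^ n * cexp (Real.pi * I * u * z s))‖ := by
    rw [integral_const_mul, norm_mul, norm_pow, Complex.norm_real, Real.norm_of_nonneg hu]
    rfl
  rw [hu']
  refine norm_integral_le_of_norm_le ((integrableOn_exp a).const_mul _)
    ((ae_restrict_iff' measurableSet_Ioi).2 (.of_forall fun s hs => ?_))
  have hs' : a < s := hs
  have hs0 : 0 ≤ s := h.nonneg.trans hs'.le
  have hre : (Real.pi * I * u * z s).re = -(Real.pi * u * (z s).im) := by simp
  have hexp : u ^ k * ‖cexp (Real.pi * I * u * z s)‖ ≤ k.factorial * (s + 2) ^ k := by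
    rw [Complex.norm_exp, hre]
    have h1 : u / (s + 1) ≤ Real.pi * u * (z s).im := by
      rw [div_eq_mul_inv]
      have := h.inv_le_im s hs'
      have := h.im_pos hs'
      calc u * (s + 1)⁻¹ ≤ u * (z s).im := by gcongr
        _ ≤ Real.pi * (u * (z s).im) :=
          le_mul_of_one_le_left (by positivity) (by linarith [Real.pi_gt_three])
        _ = _ := by ring
    have h2 := Real.pow_div_factorial_le_exp (u / (s + 1)) (by positivity) k
    rw [div_le_iff₀ (by positivity), div_pow, div_le_iff₀ (by positivity)] at h2
    calc u ^ k * Real.exp (-(Real.pi * u * (z s).im))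
        ≤ (Real.exp (u / (s + 1)) * k.factorial * (s + 1) ^ k) * Real.exp (-(u / (s + 1))) := by
          gcongr
      _ = k.factorial * (s + 1) ^ k * (Real.exp (u / (s + 1)) * Real.exp (-(u / (s + 1)))) := by
          ring
      _ = k.factorial * (s + 1) ^ k := by rw [← Real.exp_add, add_neg_cancel, Real.exp_zero, mul_one]
      _ ≤ _ := by gcongr; norm_num
  calc ‖(u : ℂ) ^ k * (c s * (Real.pi * I * z s) ^ n * cexp (Real.pi * I * u * z s))‖
      = ‖c s‖ * ‖(Real.pi * I * z s) ^ n‖ * (u ^ k * ‖cexp (Real.pi * I * u * z s)‖) := by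
        rw [norm_mul, norm_mul, norm_mul, norm_pow (u : ℂ), Complex.norm_real,
          Real.norm_of_nonneg hu]
        ring
    _ ≤ (C * Real.exp (-2 * Real.pi * s)) * (Real.pi ^ n * (s + 2) ^ n) *
        (k.factorial * (s + 2) ^ k) := by
        gcongr
        exacts [hC s hs', h.norm_pow_le n hs']
    _ = C * Real.pi ^ n * k.factorial * ((s + 2) ^ (n + k) * Real.exp (-2 * Real.pi * s)) := by
        ring
    _ ≤ C * Real.pi ^ n * k.factorial * (((n + k).factorial * Real.exp (s + 2)) *
        Real.exp (-(2 * Real.pi * s) + Real.pi * s)) := by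
        gcongr
        · exact add_two_pow_le hs0 _
        · nlinarith [Real.pi_pos]
    _ = C * Real.pi ^ n * k.factorial * (n + k).factorial *
        (Real.exp (s + 2) * Real.exp (-(2 * Real.pi * s) + Real.pi * s)) := by ring
    _ = C * Real.pi ^ n * k.factorial * (n + k).factorial *
        (Real.exp 2 * Real.exp (-(Real.pi - 1) * s)) := by
        rw [← Real.exp_add, ← Real.exp_add]
        ring_nf
    _ = _ := by ring

/-- The radial Schwartz function `x ↦ ∫ c(s) exp(π i |x|² z(s)) ds`. -/
theorem exists_schwartz (h : IsGaussianPath a c z) (E : Type*) [NormedAddCommGroup E]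
    [InnerProductSpace ℝ E] :
    ∃ f : 𝓢(E, ℂ), ∀ x, f x = superposition a c z 0 ((‖x‖ ^ 2 : ℝ) : ℂ) :=
  exists_schwartz_comp_norm_sq (fun n u => superposition a c z n (u : ℂ))
    (fun n _ hu => h.hasDerivAt_ofReal n hu) h.exists_pow_mul_norm_le


theorem norm_gaussian {V : Type*} [NormedAddCommGroup V] (v : V) (s : ℝ) :
    ‖cexp (Real.pi * I * ((‖v‖ ^ 2 : ℝ) : ℂ) * z s)‖ =
      Real.exp (-(Real.pi * (z s).im) * ‖v‖ ^ 2) := by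
  rw [Complex.norm_exp]
  congr 1
  simp only [mul_re, ofReal_re, Complex.I_re, mul_zero, ofReal_im, Complex.I_im, mul_one, sub_self, zero_mul,
    mul_im, add_zero, zero_sub]
  ring

/-! ### Fourier transform of a superposition of Gaussians -/

section Fourier

variable {V : Type*} [NormedAddCommGroup V] [InnerProductSpace ℝ V] [FiniteDimensional ℝ V]
  [MeasurableSpace V] [BorelSpace V]

/-- The integral of the modulus over `V` is `|c(s)| (Im z(s))^{-m}`, at most `|c(s)| (s+1)^m`, so
Fubini applies. -/
theorem integrable_prod (h : IsGaussianPath a c z) {m : ℕ} (hV : Module.finrank ℝ V = 2 * m)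
    (w : V) :
    Integrable (fun p : V × ℝ => Real.fourierChar (-inner ℝ p.1 w) •
      (c p.2 * cexp (Real.pi * I * ((‖p.1‖ ^ 2 : ℝ) : ℂ) * z p.2)))
      (volume.prod (volume.restrict (Ioi a))) := by
  have h1 := h.continuousOn_weight
  have h2 := h.continuousOn_path
  have hnorm : ∀ p : V × ℝ, ‖Real.fourierChar (-inner ℝ p.1 w) •
      (c p.2 * cexp (Real.pi * I * ((‖p.1‖ ^ 2 : ℝ) : ℂ) * z p.2))‖ =
      ‖c p.2‖ * Real.exp (-(Real.pi * (z p.2).im) * ‖p.1‖ ^ 2) := fun p => by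
    rw [Circle.norm_smul, norm_mul, norm_gaussian]
  have hmeas : AEStronglyMeasurable (fun p : V × ℝ => Real.fourierChar (-inner ℝ p.1 w) •
      (c p.2 * cexp (Real.pi * I * ((‖p.1‖ ^ 2 : ℝ) : ℂ) * z p.2)))
      (volume.prod (volume.restrict (Ioi a))) := by
    have : (volume : Measure V).prod (volume.restrict (Ioi a)) =
        ((volume : Measure V).prod volume).restrict (univ ×ˢ Ioi a) := by
      rw [← Measure.prod_restrict, Measure.restrict_univ]
    rw [this]
    refine ContinuousOn.aestronglyMeasurable ?_ (MeasurableSet.univ.prod measurableSet_Ioi)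
    have h1' : ContinuousOn (fun p : V × ℝ => c p.2) (univ ×ˢ Ioi a) :=
      h1.comp continuousOn_snd fun p hp => hp.2
    have h2' : ContinuousOn (fun p : V × ℝ => z p.2) (univ ×ˢ Ioi a) :=
      h2.comp continuousOn_snd fun p hp => hp.2
    have h3 : Continuous fun p : V × ℝ => Real.fourierChar (-inner ℝ p.1 w) :=
      Real.continuous_fourierChar.comp (by fun_prop)
    exact h3.continuousOn.smul (h1'.mul (by fun_prop))
  rw [integrable_prod_iff' hmeas]
  constructor
  · refine (ae_restrict_iff' measurableSet_Ioi).2 (.of_forall fun s hs => ?_)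
    have hb : 0 < Real.pi * (z s).im := mul_pos Real.pi_pos (h.im_pos hs)
    have hg := GaussianFourier.integrable_cexp_neg_mul_sq_norm_add (V := V)
      (b := -(Real.pi * I * z s)) (by simpa using hb) 0 0
    refine (Real.fourierIntegral_convergent_iff w).2 ((hg.const_mul (c s)).congr (.of_forall ?_))
    intro v
    simp only [neg_neg, zero_mul, add_zero]
    push_cast
    ring_nf
  · have heq : ∀ s ∈ Ioi a, ‖c s‖ * ((z s).im⁻¹) ^ m =
        ∫ v : V, ‖c s‖ * Real.exp (-(Real.pi * (z s).im) * ‖v‖ ^ 2) := fun s hs => by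
      have hb : 0 < Real.pi * (z s).im := mul_pos Real.pi_pos (h.im_pos hs)
      rw [integral_const_mul, GaussianFourier.integral_rexp_neg_mul_sq_norm hb, hV]
      congr 1
      rw [show ((2 * m : ℕ) : ℝ) / 2 = m by push_cast; ring, Real.rpow_natCast]
      congr 1
      field_simp
    rw [← IntegrableOn, integrableOn_congr_fun (g := fun s => ‖c s‖ * ((z s).im⁻¹) ^ m)
      (fun s hs => by
        refine Eq.trans ?_ (heq s hs).symm
        exact integral_congr_ae (.of_forall fun v => hnorm (v, s))) measurableSet_Ioi]
    obtain ⟨C, hC0, hC⟩ := h.exists_norm_weight_le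
    have hcont : ContinuousOn (fun s => ‖c s‖ * ((z s).im⁻¹) ^ m) (Ioi a) :=
      h1.norm.mul (((Complex.continuous_im.comp_continuousOn h2).inv₀
        fun s hs => (h.im_pos hs).ne').pow m)
    refine Integrable.mono' ((integrableOn_exp a).const_mul (C * (m.factorial * Real.exp 2)))
      (hcont.aestronglyMeasurable measurableSet_Ioi)
      ((ae_restrict_iff' measurableSet_Ioi).2 (.of_forall fun s hs => ?_))
    have hs' : a < s := hs
    have hs0 : 0 ≤ s := h.nonneg.trans hs'.le
    have him := h.im_pos hs'
    rw [Real.norm_of_nonneg (by positivity)]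
    calc ‖c s‖ * ((z s).im⁻¹) ^ m
        ≤ (C * Real.exp (-(2 * Real.pi * s) + Real.pi * s)) *
          (m.factorial * Real.exp (s + 2)) := by
          gcongr
          · refine (hC s hs').trans ?_
            gcongr
            nlinarith [Real.pi_pos]
          · refine le_trans ?_ (add_two_pow_le hs0 m)
            gcongr
            refine (inv_anti₀ (by positivity) (h.inv_le_im s hs')).trans ?_
            rw [inv_inv]
            linarith
      _ = C * m.factorial *
          (Real.exp (-(2 * Real.pi * s) + Real.pi * s) * Real.exp (s + 2)) := by ring
      _ = C * m.factorial * (Real.exp 2 * Real.exp (-(Real.pi - 1) * s)) := by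
          rw [← Real.exp_add, ← Real.exp_add]
          ring_nf
      _ = _ := by ring

theorem fourier_superposition (h : IsGaussianPath a c z) {m : ℕ}
    (hV : Module.finrank ℝ V = 2 * m) (w : V) :
    𝓕 (fun v : V => superposition a c z 0 ((‖v‖ ^ 2 : ℝ) : ℂ)) w =
      superposition a (fun s => c s * (I / z s) ^ m) (fun s => -1 / z s) 0 ((‖w‖ ^ 2 : ℝ) : ℂ) := by
  rw [Real.fourier_eq]
  have hsm : ∀ v : V, Real.fourierChar (-inner ℝ v w) •
      superposition a c z 0 ((‖v‖ ^ 2 : ℝ) : ℂ) = ∫ s in Ioi a, Real.fourierChar (-inner ℝ v w) •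
      (c s * cexp (Real.pi * I * ((‖v‖ ^ 2 : ℝ) : ℂ) * z s)) := fun v => by
    simp only [superposition, pow_zero, mul_one, Circle.smul_def, smul_eq_mul]
    rw [← integral_const_mul]
  simp only [hsm]
  rw [integral_integral_swap (h.integrable_prod hV w), superposition]
  refine setIntegral_congr_fun measurableSet_Ioi fun s hs => ?_
  have hb : 0 < Real.pi * (z s).im := mul_pos Real.pi_pos (h.im_pos hs)
  have hz0 : z s ≠ 0 := fun h0 => by simp [h0] at hb
  have hpi : (Real.pi : ℂ) ≠ 0 := by exact_mod_cast Real.pi_ne_zero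
  have hg := fourier_gaussian_innerProductSpace (V := V) (b := -(Real.pi * I * z s))
    (by simpa using hb) w
  rw [Real.fourier_eq, hV] at hg
  have hint : ∫ v : V, Real.fourierChar (-inner ℝ v w) •
      (c s * cexp (Real.pi * I * ((‖v‖ ^ 2 : ℝ) : ℂ) * z s)) =
      c s * ∫ v : V, Real.fourierChar (-inner ℝ v w) •
        cexp (-(-(Real.pi * I * z s)) * ‖v‖ ^ 2) := by
    rw [← integral_const_mul]
    congr 1 with v
    rw [mul_smul_comm]
    congr 3
    push_cast
    ring
  rw [hint, hg, show (((2 * m : ℕ) : ℂ) / 2) = (m : ℂ) by push_cast; ring, Complex.cpow_natCast,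
    pow_zero, mul_one, ← mul_assoc]
  have h1 : (Real.pi : ℂ) / -(Real.pi * I * z s) = I / z s := by
    field_simp
    simp
  rw [h1]
  congr 2
  push_cast
  field_simp
  ring_nf
  simp

end Fourier

end IsGaussianPath

/-! ### Contour deformation -/

/-- The truncation `[1/T, T]` is the one compatible with `w ↦ -1/w`, which carries `iT` to `i/T`. -/
theorem tendsto_intervalIntegral_inv_id {f : ℝ → ℂ} (hf : IntegrableOn f (Ioi 0)) :
    Tendsto (fun T : ℝ => ∫ t in T⁻¹..T, f t) atTop (𝓝 (∫ t in Ioi 0, f t)) := by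
  have hcover : AECover (volume.restrict (Ioi (0 : ℝ))) atTop (fun T : ℝ => Ioc T⁻¹ T) := by
    refine aecover_restrict_of_ae_imp measurableSet_Ioi (.of_forall fun x hx => ?_)
      fun _ => measurableSet_Ioc
    filter_upwards [eventually_ge_atTop x, eventually_gt_atTop x⁻¹, eventually_gt_atTop 0]
      with T h1 h2 h3
    exact ⟨inv_lt_of_inv_lt₀ hx h2, h1⟩
  refine (hcover.integral_tendsto_of_countably_generated hf).congr' ?_
  filter_upwards [eventually_ge_atTop 1] with T hT
  have hT0 : 0 < T := by linarith
  rw [intervalIntegral.integral_of_le ((inv_le_one_of_one_le₀ hT).trans hT),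
    Measure.restrict_restrict measurableSet_Ioc, inter_eq_left.2]
  exact fun x hx => (inv_pos.2 hT0).trans hx.1

theorem norm_sub_le_of_horizontal_segment {G g : ℂ → ℂ} {ε y B : ℝ} (hε : |ε| ≤ 1)
    (hG : ∀ x : ℝ, |x| ≤ 1 → HasDerivAt G (g (x + I * y)) (x + I * y))
    (hB : ∀ x : ℝ, |x| ≤ 1 → ‖g (x + I * y)‖ ≤ B) :
    ‖G (ε + I * y) - G (I * y)‖ ≤ B := by
  have hB0 : 0 ≤ B := (norm_nonneg _).trans (hB 0 (by simp))
  have h : ∀ x ∈ Icc (-1 : ℝ) 1,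
      HasDerivWithinAt (fun x : ℝ => G (x + I * y)) (g (x + I * y)) (Icc (-1) 1) x := fun x hx => by
    have := (hG x (abs_le.2 hx)).comp_add_const (x : ℂ) (I * y)
    exact this.comp_ofReal.hasDerivWithinAt
  have h2 := (convex_Icc (-1 : ℝ) 1).norm_image_sub_le_of_norm_hasDerivWithin_le h
    (fun x hx => hB x (abs_le.2 hx)) (show (0 : ℝ) ∈ Icc (-1 : ℝ) 1 by simp)
    (show ε ∈ Icc (-1 : ℝ) 1 from abs_le.1 hε)
  simp only [ofReal_zero, zero_add, sub_zero, Real.norm_eq_abs] at h2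
  exact h2.trans (mul_le_of_le_one_right hB0 hε)

theorem hasDerivAt_vertical {G : ℂ → ℂ} {g' x : ℂ} {t : ℝ} (hG : HasDerivAt G g' (x + I * t)) :
    HasDerivAt (fun t : ℝ => G (x + I * t)) (g' * I) t := by
  have h1 : HasDerivAt (fun w : ℂ => x + I * w) I (t : ℂ) := by
    simpa using ((hasDerivAt_id (t : ℂ)).const_mul I).const_add x
  exact (HasDerivAt.comp (t : ℂ) hG h1).comp_ofReal

theorem integral_vertical {G g : ℂ → ℂ} {x : ℂ} {a b : ℝ}
    (hG : ∀ t ∈ uIcc a b, HasDerivAt G (g (x + I * t)) (x + I * t))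
    (hg : ContinuousOn (fun t : ℝ => g (x + I * t)) (uIcc a b)) :
    ∫ t in a..b, g (x + I * t) * I = G (x + I * b) - G (x + I * a) :=
  intervalIntegral.integral_eq_sub_of_hasDerivAt (f := fun t : ℝ => G (x + I * t))
    (fun t ht => hasDerivAt_vertical (hG t ht))
    ((hg.mul continuousOn_const).intervalIntegrable)

/-- For `g` holomorphic on the upper half plane, the integral of `g` along the imaginary axis is
shifted to the circular arc from `0` to `ε + i` (the image of the line `Re w = -ε/2` under
`w ↦ -1/w`) followed by the vertical ray from `ε + i`. -/
theorem integral_imaginary_axis_eq {g : ℂ → ℂ} (hg : DifferentiableOn ℂ g {z | 0 < z.im})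
    {ε : ℝ} (hε : ε ^ 2 = 1) {B₁ B₂ : ℝ → ℝ} (hB₁ : Tendsto B₁ atTop (𝓝 0))
    (hB₂ : Tendsto B₂ atTop (𝓝 0))
    (htop : ∀ T : ℝ, 1 ≤ T → ∀ x : ℝ, |x| ≤ 1 → ‖g (x + I * T)‖ ≤ B₁ T)
    (hbot : ∀ T : ℝ, 1 ≤ T → ∀ x : ℝ, |x| ≤ 1 →
      ‖g (-1 / (x + I * T)) / (x + I * T) ^ 2‖ ≤ B₂ T)
    (hint₁ : IntegrableOn (fun t : ℝ => g (I * t) * I) (Ioi 0))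
    (hint₂ : IntegrableOn (fun t : ℝ => g (ε + I * t) * I) (Ioi 1))
    (hint₃ : IntegrableOn (fun t : ℝ => g (-1 / (((-ε / 2 : ℝ) : ℂ) + I * t)) /
      (((-ε / 2 : ℝ) : ℂ) + I * t) ^ 2 * I) (Ioi (1 / 2))) :
    ∫ t in Ioi (0 : ℝ), g (I * t) * I = (∫ t in Ioi (1 : ℝ), g (ε + I * t) * I) -
      ∫ t in Ioi (1 / 2 : ℝ), g (-1 / (((-ε / 2 : ℝ) : ℂ) + I * t)) /
        (((-ε / 2 : ℝ) : ℂ) + I * t) ^ 2 * I := by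
  have hε1 : |ε| = 1 := by
    rw [← Real.sqrt_sq_eq_abs, hε, Real.sqrt_one]
  set h : ℂ → ℂ := fun w => g (-1 / w) / w ^ 2 with hh
  have him : ∀ w : ℂ, 0 < w.im → 0 < (-1 / w).im := fun w hw => by
    have hw0 : w ≠ 0 := fun h0 => by simp [h0] at hw
    rw [neg_div, one_div, neg_im, Complex.inv_im, neg_div, neg_neg]
    exact div_pos hw (Complex.normSq_pos.2 hw0)
  have hhdiff : DifferentiableOn ℂ h {z | 0 < z.im} := by
    refine DifferentiableOn.div (hg.comp (DifferentiableOn.div (by fun_prop) (by fun_prop) ?_) him)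
      (by fun_prop) ?_
    · rintro w hw rfl
      simp at hw
    · intro w hw
      refine pow_ne_zero 2 ?_
      rintro rfl
      simp at hw
  -- The truncated contours differ by two short pieces: a horizontal segment at height `T`, and the
  -- image of another under `w ↦ -1/w`.
  have key : ∀ T : ℝ, 1 ≤ T → ‖(∫ t in T⁻¹..T, g (I * t) * I) - ((∫ t in (1 : ℝ)..T,
      g (ε + I * t) * I) - ∫ t in (1 / 2 : ℝ)..T, h (((-ε / 2 : ℝ) : ℂ) + I * t) * I)‖ ≤
      B₁ T + B₂ T := by
    intro T hT
    have hT0 : 0 < T := by linarith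
    -- A disc tangent to the real line at `0`, large enough to contain all the truncated contours;
    -- on it `g` has a primitive `G`, so every integral becomes a difference of values of `G`.
    have hball : Metric.ball (I * (1 + T ^ 2 : ℝ)) (1 + T ^ 2) ⊆ {z : ℂ | 0 < z.im} := by
      intro z hz
      rw [Metric.mem_ball, Complex.dist_eq] at hz
      have := (Complex.abs_im_le_norm _).trans_lt hz
      rw [abs_lt] at this
      have h1 := this.1
      simp only [sub_im, mul_im, Complex.I_re, zero_mul, Complex.I_im, one_mul, ofReal_re,
        zero_add] at h1
      change 0 < z.im
      linarith
    have hmem : ∀ z : ℂ, z.re ^ 2 + z.im ^ 2 < 2 * (1 + T ^ 2) * z.im →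
        z ∈ Metric.ball (I * (1 + T ^ 2 : ℝ)) (1 + T ^ 2) := by
      intro z hz
      rw [Metric.mem_ball, Complex.dist_eq]
      refine lt_of_pow_lt_pow_left₀ 2 (by positivity) ?_
      rw [← Complex.normSq_eq_norm_sq, Complex.normSq_apply]
      simp only [sub_re, mul_re, Complex.I_re, ofReal_re, Complex.I_im, ofReal_im, sub_im, mul_im]
      nlinarith
    obtain ⟨G, hG⟩ := (hg.mono hball).isExactOn_ball
    have hGtop : ∀ x t : ℝ, |x| ≤ 1 → 1 ≤ t → t ≤ T →
        HasDerivAt G (g (x + I * t)) (x + I * t) := fun x t hx h1 h2 => by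
      refine hG _ (hmem _ ?_)
      have hx2 : x ^ 2 ≤ 1 := by rwa [sq_le_one_iff_abs_le_one]
      simp
      nlinarith
    have hGaxis : ∀ t : ℝ, t ∈ uIcc T⁻¹ T → HasDerivAt G (g (0 + I * t)) (0 + I * t) := by
      intro t ht
      rw [uIcc_of_le ((inv_le_one_of_one_le₀ hT).trans hT)] at ht
      have ht0 : 0 < t := (inv_pos.2 hT0).trans_le ht.1
      refine hG _ (hmem _ ?_)
      have h2 : t < 2 * (1 + T ^ 2) := by nlinarith [ht.2]
      simpa [sq] using mul_lt_mul_of_pos_right h2 ht0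
    have hK : ∀ x t : ℝ, |x| ≤ 1 → 1 / 2 ≤ t → t ≤ T →
        HasDerivAt (fun w => G (-1 / w)) (h (x + I * t)) (x + I * t) := fun x t hx h1 h2 => by
      have ht0 : 0 < t := by linarith
      set w : ℂ := x + I * t with hw
      have hwim : w.im = t := by simp [hw]
      have hw0 : w ≠ 0 := fun h0 => by simp [h0] at hwim; linarith
      have hd : HasDerivAt (fun w : ℂ => -1 / w) (1 / w ^ 2) w := by
        have := (hasDerivAt_inv hw0).neg
        simp only [neg_neg] at this
        refine (this.congr_of_eventuallyEq (.of_forall fun v => ?_)).congr_deriv ?_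
        · simp [neg_div]
        · simp
      have hGw : HasDerivAt G (g (-1 / w)) (-1 / w) := by
        refine hG _ (hmem _ ?_)
        have hn : 0 < Complex.normSq w := Complex.normSq_pos.2 hw0
        have e1 : (-1 / w).re ^ 2 + (-1 / w).im ^ 2 = (Complex.normSq w)⁻¹ := by
          have := Complex.normSq_apply (-1 / w)
          rw [Complex.normSq_div, Complex.normSq_neg, Complex.normSq_one, one_div] at this
          rw [this]
          ring
        have e2 : (-1 / w).im = t / Complex.normSq w := by
          rw [neg_div, one_div, neg_im, Complex.inv_im, neg_div, neg_neg, hwim]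
        rw [e1, e2, ← mul_div_assoc, inv_eq_one_div]
        gcongr
        nlinarith
      have := HasDerivAt.comp w hGw hd
      refine this.congr_deriv ?_
      simp only [hh]
      ring
    have hcont : ∀ {f : ℂ → ℂ} {x a b : ℝ}, DifferentiableOn ℂ f {z | 0 < z.im} → 0 < a → a ≤ b →
        ContinuousOn (fun t : ℝ => f (x + I * t)) (uIcc a b) := by
      intro f x a b hf ha hab
      refine hf.continuousOn.comp (by fun_prop) fun t ht => ?_
      rw [uIcc_of_le hab] at ht
      simpa using ha.trans_le ht.1
    have e1 : ∫ t in T⁻¹..T, g (I * t) * I = G (I * T) - G (I * (T⁻¹ : ℝ)) := by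
      have := integral_vertical hGaxis (by
        simpa using hcont (x := 0) hg (inv_pos.2 hT0) ((inv_le_one_of_one_le₀ hT).trans hT))
      simpa only [zero_add] using this
    have e2 : ∫ t in (1 : ℝ)..T, g (ε + I * t) * I = G (ε + I * T) - G (ε + I * (1 : ℝ)) := by
      refine integral_vertical (fun t ht => ?_) (hcont hg one_pos hT)
      rw [uIcc_of_le hT] at ht
      exact hGtop ε t hε1.le ht.1 ht.2
    have hε2 : |(-ε / 2)| ≤ 1 := by rw [abs_div, abs_neg, hε1]; norm_num
    have e3 : ∫ t in (1 / 2 : ℝ)..T, h (((-ε / 2 : ℝ) : ℂ) + I * t) * I =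
        G (-1 / (((-ε / 2 : ℝ) : ℂ) + I * T)) -
        G (-1 / (((-ε / 2 : ℝ) : ℂ) + I * (1 / 2 : ℝ))) := by
      refine integral_vertical (G := fun w => G (-1 / w)) (fun t ht => ?_)
        (hcont hhdiff (by norm_num) (by linarith))
      rw [uIcc_of_le (by linarith)] at ht
      exact hK _ t hε2 ht.1 ht.2
    -- The arc meets the vertical ray here, which explains the starting height `1/2` on the line `Re
    -- w = -ε/2`.
    have hpt : -1 / (((-ε / 2 : ℝ) : ℂ) + I * (1 / 2 : ℝ)) = ε + I * (1 : ℝ) := by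
      have hne : ((-ε / 2 : ℝ) : ℂ) + I * (1 / 2 : ℝ) ≠ 0 := fun h0 => by
        have := congrArg Complex.im h0
        simp at this
      rw [div_eq_iff hne]
      have : (ε : ℂ) ^ 2 = 1 := by exact_mod_cast hε
      push_cast
      linear_combination (1 / 2 : ℂ) * this - (1 / 2 : ℂ) * I_sq
    have hpt2 : -1 / (I * (T : ℂ)) = I * (T⁻¹ : ℝ) := by
      have : (T : ℂ) ≠ 0 := by exact_mod_cast hT0.ne'
      push_cast
      field_simp
      simp
    have n1 := norm_sub_le_of_horizontal_segment (G := G) (y := T) hε1.le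
      (fun x hx => hGtop x T hx hT le_rfl) (htop T hT)
    have n2 := norm_sub_le_of_horizontal_segment (G := fun w => G (-1 / w)) (g := h) (y := T) hε2
      (fun x hx => hK x T hx (by linarith) le_rfl) (hbot T hT)
    rw [hpt2] at n2
    rw [e1, e2, e3, hpt]
    calc _ = ‖-(G (ε + I * T) - G (I * T)) +
          (G (-1 / (((-ε / 2 : ℝ) : ℂ) + I * T)) - G (I * (T⁻¹ : ℝ)))‖ := by congr 1; ring
      _ ≤ _ := by
        refine (norm_add_le _ _).trans ?_
        rw [norm_neg]
        exact add_le_add n1 n2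
  have hlim := (tendsto_intervalIntegral_inv_id hint₁).sub
    ((intervalIntegral_tendsto_integral_Ioi 1 hint₂ tendsto_id).sub
      (intervalIntegral_tendsto_integral_Ioi (1 / 2) hint₃ tendsto_id))
  have hzero : Tendsto (fun T : ℝ => (∫ t in T⁻¹..T, g (I * t) * I) - ((∫ t in (1 : ℝ)..T,
      g (ε + I * t) * I) - ∫ t in (1 / 2 : ℝ)..T, h (((-ε / 2 : ℝ) : ℂ) + I * t) * I))
      atTop (𝓝 0) := by
    refine squeeze_zero_norm' ?_ (by simpa using hB₁.add hB₂)
    filter_upwards [eventually_ge_atTop 1] with T hT using key T hT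
  exact sub_eq_zero.1 (tendsto_nhds_unique hlim hzero)

/-! ### The four Gaussian paths -/

theorem continuousOn_phi_vertical (x a : ℝ) (ha : 0 ≤ a) :
    ContinuousOn (fun s : ℝ => phi (x + I * s)) (Ioi a) := by
  refine differentiableOn_phi.continuousOn.comp (by fun_prop) fun s hs => ?_
  have : a < s := hs
  simpa using ha.trans_lt this

/-- The vertical line `Re w = -ε/2`. -/
noncomputable def line (ε s : ℝ) : ℂ := ((-ε / 2 : ℝ) : ℂ) + I * s

theorem line_im (ε s : ℝ) : (line ε s).im = s := by simp [line]

theorem line_re (ε s : ℝ) : (line ε s).re = -ε / 2 := by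
  simp only [line, add_re, ofReal_re, mul_re, Complex.I_re, zero_mul, Complex.I_im, ofReal_im,
    mul_zero, sub_self, add_zero]

theorem line_ne_zero (ε : ℝ) {s : ℝ} (hs : 0 < s) : line ε s ≠ 0 := fun h => by
  have := line_im ε s
  rw [h] at this
  simp at this
  exact hs.ne this

theorem continuous_line (ε : ℝ) : Continuous (line ε) := by
  unfold line
  fun_prop

/-- The circular arc from `-ε` (at `s = ∞`) to `i` (at `s = 1/2`). -/
noncomputable def arcPath (ε s : ℝ) : ℂ := -ε - 1 / line ε s

/-- The weight attached to `arcPath`. -/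
noncomputable def arcWeight (ε s : ℝ) : ℂ := -I * (phi (line ε s) / line ε s ^ 12)

theorem half_pow_le_norm_pow {w : ℂ} (hw : 1 / 2 ≤ w.im) (n : ℕ) : (1 / 2 : ℝ) ^ n ≤ ‖w ^ n‖ := by
  rw [norm_pow]
  gcongr
  exact hw.trans ((le_abs_self _).trans (Complex.abs_im_le_norm w))

theorem exists_norm_phi_div_pow_le (n : ℕ) : ∃ C, 0 ≤ C ∧ ∀ w : ℂ, 1 / 2 ≤ w.im →
    ‖phi w / w ^ n‖ ≤ C * Real.exp (-2 * Real.pi * w.im) := by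
  obtain ⟨C, hC0, hC⟩ := exists_norm_phi_le
  refine ⟨C / (1 / 2) ^ n, by positivity, fun w hw => ?_⟩
  rw [norm_div, div_mul_eq_mul_div]
  exact div_le_div₀ (by positivity) (hC w hw) (by positivity) (half_pow_le_norm_pow hw n)

theorem normSq_line {ε : ℝ} (hε : ε ^ 2 = 1) (s : ℝ) :
    Complex.normSq (line ε s) = 1 / 4 + s ^ 2 := by
  rw [Complex.normSq_apply, line_re, line_im]
  linear_combination (1 / 4) * hε

theorem isGaussianPath_arc {ε : ℝ} (hε : ε ^ 2 = 1) :
    IsGaussianPath (1 / 2) (arcWeight ε) (arcPath ε) := by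
  have hne : ∀ s ∈ Ioi (1 / 2 : ℝ), line ε s ≠ 0 := fun s hs =>
    line_ne_zero ε (lt_trans (by norm_num) hs)
  have hline := (continuous_line ε).continuousOn (s := Ioi (1 / 2 : ℝ))
  have hε1 : |ε| = 1 := by rw [← Real.sqrt_sq_eq_abs, hε, Real.sqrt_one]
  have him : ∀ s, (arcPath ε s).im = s / (1 / 4 + s ^ 2) := fun s => by
    rw [arcPath, one_div, sub_im, Complex.inv_im, normSq_line hε, line_im]
    simp
    ring
  refine ⟨by norm_num, ?_, ?_, ?_, fun s hs => ?_, fun s hs => ?_, fun s hs => ?_⟩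
  · exact continuousOn_const.mul ((continuousOn_phi_vertical _ _ (by norm_num)).div
      (hline.pow 12) fun s hs => pow_ne_zero _ (hne s hs))
  · exact continuousOn_const.sub (continuousOn_const.div hline hne)
  · obtain ⟨C, hC0, hC⟩ := exists_norm_phi_div_pow_le 12
    refine ⟨C, hC0, fun s hs => ?_⟩
    have := hC (line ε s) (by rw [line_im]; exact hs.le)
    rw [line_im] at this
    rwa [arcWeight, norm_mul, norm_neg, Complex.norm_I, one_mul]
  · have : (arcPath ε s).re = -ε * (1 - (1 / 2) / (1 / 4 + s ^ 2)) := by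
      rw [arcPath, one_div, sub_re, Complex.inv_re, normSq_line hε, line_re]
      simp
      ring
    rw [this, abs_mul, abs_neg, hε1, one_mul, abs_le]
    have h1 : (1 / 2 : ℝ) / (1 / 4 + s ^ 2) ≤ 1 := by
      rw [div_le_one (by positivity)]
      nlinarith
    have h2 : (0 : ℝ) ≤ (1 / 2 : ℝ) / (1 / 4 + s ^ 2) := by positivity
    constructor <;> linarith
  · rw [him, inv_eq_one_div, div_le_div_iff₀ (by linarith) (by positivity)]
    nlinarith
  · rw [him, div_le_iff₀ (by positivity)]
    nlinarith [pow_pos (show 0 < s by linarith) 3]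

/-- The weight attached to `axisPath`. -/
noncomputable def axisWeight (s : ℝ) : ℂ := 2 * I * phi (I * s)

/-- The ray from `i` to `i∞`. -/
noncomputable def axisPath (s : ℝ) : ℂ := I * s

/-- The weight attached to `invAxisPath`. -/
noncomputable def invAxisWeight (s : ℝ) : ℂ := 2 * I * (phi (I * s) / s ^ 12)

/-- The segment from `i` to `0`. -/
noncomputable def invAxisPath (s : ℝ) : ℂ := I / s

theorem continuousOn_phi_axis : ContinuousOn (fun s : ℝ => phi (I * s)) (Ioi 0) := by
  simpa using continuousOn_phi_vertical 0 0 le_rfl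

theorem isGaussianPath_axis : IsGaussianPath 1 axisWeight axisPath := by
  refine ⟨by norm_num, ?_, ?_, ?_, fun s hs => ?_, fun s hs => ?_, fun s hs => ?_⟩
  · exact continuousOn_const.mul (continuousOn_phi_axis.mono (Ioi_subset_Ioi (by norm_num)))
  · unfold axisPath
    fun_prop
  · obtain ⟨C, hC0, hC⟩ := exists_norm_phi_le
    refine ⟨2 * C, by positivity, fun s hs => ?_⟩
    have := hC (I * s) (by simp; linarith)
    simp [axisWeight] at this ⊢
    linarith
  · simp [axisPath]
  · simp only [axisPath, I_mul_im, ofReal_re]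
    exact (inv_le_one_of_one_le₀ (by linarith)).trans hs.le
  · simp [axisPath]

theorem isGaussianPath_invAxis : IsGaussianPath 1 invAxisWeight invAxisPath := by
  have hne : ∀ s ∈ Ioi (1 : ℝ), (s : ℂ) ≠ 0 := fun s hs => by
    exact_mod_cast (lt_trans one_pos hs).ne'
  have him : ∀ s, (invAxisPath s).im = s⁻¹ := fun s => by
    rw [invAxisPath, Complex.div_ofReal_im, Complex.I_im, one_div]
  refine ⟨by norm_num, ?_, ?_, ?_, fun s hs => ?_, fun s hs => ?_, fun s hs => ?_⟩
  · exact continuousOn_const.mul ((continuousOn_phi_axis.mono (Ioi_subset_Ioi (by norm_num))).div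
      (by fun_prop) fun s hs => pow_ne_zero _ (hne s hs))
  · exact continuousOn_const.div (by fun_prop) hne
  · obtain ⟨C, hC0, hC⟩ := exists_norm_phi_le
    refine ⟨2 * C, by positivity, fun s hs => ?_⟩
    have := hC (I * s) (by simp; linarith)
    have h1 : ‖phi (I * s) / (s : ℂ) ^ 12‖ ≤ ‖phi (I * s)‖ := by
      rw [norm_div]
      refine div_le_self (norm_nonneg _) ?_
      rw [norm_pow, Complex.norm_real, Real.norm_of_nonneg (by linarith)]
      exact one_le_pow₀ hs.le
    rw [invAxisWeight, norm_mul, norm_mul, Complex.norm_I]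
    simp at this ⊢
    simp at h1
    linarith
  · rw [invAxisPath, Complex.div_ofReal_re]
    simp
  · rw [him]
    exact inv_anti₀ (by linarith) (by linarith)
  · rw [him]
    exact (inv_le_one_of_one_le₀ hs.le).trans (by linarith)

/-! ### The Fourier transform permutes the four pieces -/

theorem superposition_congr {a : ℝ} {c c' z z' : ℝ → ℂ} (hc : ∀ s, a < s → c s = c' s)
    (hz : ∀ s, a < s → z s = z' s) (n : ℕ) (u : ℂ) :
    superposition a c z n u = superposition a c' z' n u :=
  setIntegral_congr_fun measurableSet_Ioi fun s hs => by
    simp only [hc s hs, hz s hs]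

theorem line_mul_eq {ε : ℝ} (hε : ε ^ 2 = 1) (s : ℝ) : ε * line ε s + 1 = ε * line (-ε) s := by
  have : (ε : ℂ) ^ 2 = 1 := by exact_mod_cast hε
  simp only [line]
  push_cast
  linear_combination -this

/-- In this form `-1/z` visibly exchanges the arcs for `ε` and `-ε`, and `z^{-12}` replaces `line ε
s ^ 12` by `line (-ε) s ^ 12` in the denominator of the weight. -/
theorem arcPath_eq {ε : ℝ} (hε : ε ^ 2 = 1) {s : ℝ} (hs : 0 < s) :
    arcPath ε s = -ε * (line (-ε) s / line ε s) := by
  have h1 := line_mul_eq hε s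
  have h2 := line_ne_zero ε hs
  rw [arcPath]
  field_simp
  linear_combination -h1

theorem phi_line_neg {ε : ℝ} (hε : ε ^ 2 = 1) (s : ℝ) : phi (line (-ε) s) = phi (line ε s) := by
  have h : ∀ ε : ℝ, line (-ε) s = line ε s + ε := fun ε => by
    simp only [line]
    push_cast
    ring
  rcases mul_self_eq_one_iff.1 ((sq ε).symm.trans hε) with rfl | rfl
  · rw [h, ofReal_one, phi_add_one]
  · have := h 1
    rw [neg_neg, this, ofReal_one, phi_add_one]

theorem fourier_arc {ε : ℝ} (hε : ε ^ 2 = 1) (w : EuclideanSpace ℝ (Fin 24)) :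
    𝓕 (fun v : EuclideanSpace ℝ (Fin 24) =>
      superposition (1 / 2) (arcWeight ε) (arcPath ε) 0 ((‖v‖ ^ 2 : ℝ) : ℂ)) w =
      superposition (1 / 2) (arcWeight (-ε)) (arcPath (-ε)) 0 ((‖w‖ ^ 2 : ℝ) : ℂ) := by
  rw [(isGaussianPath_arc hε).fourier_superposition (m := 12) (by simp)]
  have hεc : (ε : ℂ) ^ 2 = 1 := by exact_mod_cast hε
  have hε0 : (ε : ℂ) ≠ 0 := fun h => by simp [h] at hεc
  have hε' : (-ε) ^ 2 = 1 := by rw [neg_sq, hε]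
  refine superposition_congr (fun s hs => ?_) (fun s hs => ?_) _ _
  · have hs0 : 0 < s := lt_trans (by norm_num) hs
    have h1 := line_ne_zero ε hs0
    have h2 := line_ne_zero (-ε) hs0
    have hI : I ^ 12 = 1 := by rw [show 12 = 4 * 3 by norm_num, pow_mul, Complex.I_pow_four, one_pow]
    have hε12 : (ε : ℂ) ^ 12 = 1 := by rw [show 12 = 2 * 6 by norm_num, pow_mul, hεc, one_pow]
    rw [arcPath_eq hε hs0, arcWeight, arcWeight, phi_line_neg hε, div_pow, mul_pow, div_pow,
      neg_pow, hI, hε12]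
    norm_num
    field_simp
  · have hs0 : 0 < s := lt_trans (by norm_num) hs
    have h1 := line_ne_zero ε hs0
    have h2 := line_ne_zero (-ε) hs0
    rw [arcPath_eq hε hs0, arcPath_eq hε' hs0, neg_neg]
    push_cast
    field_simp
    linear_combination -hεc

theorem fourier_axis (w : EuclideanSpace ℝ (Fin 24)) :
    𝓕 (fun v : EuclideanSpace ℝ (Fin 24) =>
      superposition 1 axisWeight axisPath 0 ((‖v‖ ^ 2 : ℝ) : ℂ)) w =
      superposition 1 invAxisWeight invAxisPath 0 ((‖w‖ ^ 2 : ℝ) : ℂ) := by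
  rw [isGaussianPath_axis.fourier_superposition (m := 12) (by simp)]
  refine superposition_congr (fun s hs => ?_) (fun s hs => ?_) _ _
  · have hs0 : (s : ℂ) ≠ 0 := by exact_mod_cast (lt_trans one_pos hs).ne'
    rw [axisWeight, axisPath, invAxisWeight, div_mul_cancel_left₀ I_ne_zero, inv_pow]
    ring
  · have hs0 : (s : ℂ) ≠ 0 := by exact_mod_cast (lt_trans one_pos hs).ne'
    rw [axisPath, invAxisPath]
    field_simp
    simp

theorem fourier_invAxis (w : EuclideanSpace ℝ (Fin 24)) :
    𝓕 (fun v : EuclideanSpace ℝ (Fin 24) =>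
      superposition 1 invAxisWeight invAxisPath 0 ((‖v‖ ^ 2 : ℝ) : ℂ)) w =
      superposition 1 axisWeight axisPath 0 ((‖w‖ ^ 2 : ℝ) : ℂ) := by
  rw [isGaussianPath_invAxis.fourier_superposition (m := 12) (by simp)]
  refine superposition_congr (fun s hs => ?_) (fun s hs => ?_) _ _
  · have hs0 : (s : ℂ) ≠ 0 := by exact_mod_cast (lt_trans one_pos hs).ne'
    rw [axisWeight, invAxisPath, invAxisWeight, div_div_cancel₀ I_ne_zero]
    field_simp
  · have hs0 : (s : ℂ) ≠ 0 := by exact_mod_cast (lt_trans one_pos hs).ne'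
    rw [axisPath, invAxisPath]
    field_simp
    simp

/-! ### Bounds for the integrand and absolute convergence -/

theorem neg_one_div_im_pos {z : ℂ} (hz : 0 < z.im) : 0 < (-1 / z).im := by
  have hz0 : z ≠ 0 := fun h0 => by simp [h0] at hz
  rw [neg_div, one_div, neg_im, Complex.inv_im, neg_div, neg_neg]
  exact div_pos hz (Complex.normSq_pos.2 hz0)

theorem differentiableOn_integrand (r : ℝ) :
    DifferentiableOn ℂ (integrand r) {z | 0 < z.im} := by
  have h : DifferentiableOn ℂ (fun z : ℂ => phi (-1 / z)) {z | 0 < z.im} := by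
    refine differentiableOn_phi.comp (DifferentiableOn.div (by fun_prop) (by fun_prop) ?_)
      fun z hz => neg_one_div_im_pos hz
    rintro w hw rfl
    simp at hw
  unfold integrand
  fun_prop

/-- The weakly holomorphic function `z ^ 10 * φ (-1 / z)`. -/
noncomputable def phiInv (z : ℂ) : ℂ := phi (-1 / z) * z ^ 10

theorem integrand_eq (r : ℝ) (z : ℂ) :
    integrand r z = phiInv z * cexp (Real.pi * I * (r : ℂ) ^ 2 * z) := rfl

theorem exists_norm_phiInv_le : ∃ C, 0 ≤ C ∧ ∀ x t : ℝ, |x| ≤ 1 → 1 ≤ t →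
    ‖phiInv (x + I * t)‖ ≤ C * (t + 1) ^ 2 * Real.exp (4 * Real.pi * t) := by
  obtain ⟨C₀, h₀, H₀⟩ := exists_norm_phi_le
  obtain ⟨C₁, h₁, H₁⟩ := exists_norm_phiOne_le
  obtain ⟨C₂, h₂, H₂⟩ := exists_norm_phiTwo_le
  refine ⟨C₀ + C₁ + C₂, by positivity, fun x t hx ht => ?_⟩
  set z : ℂ := x + I * t with hz
  have him : z.im = t := by simp [hz]
  have hnorm : ‖z‖ ≤ t + 1 := by
    refine (norm_add_le _ _).trans ?_
    rw [norm_mul, Complex.norm_I, one_mul, Complex.norm_real, Complex.norm_real, Real.norm_eq_abs,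
      Real.norm_of_nonneg (by linarith)]
    linarith
  have hhalf : 1 / 2 ≤ z.im := by rw [him]; linarith
  have hpi := Real.pi_pos
  have b₀ := H₀ z hhalf
  have b₁ := H₁ z hhalf
  have b₂ := H₂ z hhalf
  rw [him] at b₀ b₁ b₂
  rw [phiInv, phi_neg_one_div_mul (by rw [him]; linarith)]
  calc ‖phi z * z ^ 2 + phiOne z * z + phiTwo z‖
      ≤ ‖phi z‖ * ‖z‖ ^ 2 + ‖phiOne z‖ * ‖z‖ + ‖phiTwo z‖ := by
        refine (norm_add_le _ _).trans (add_le_add ((norm_add_le _ _).trans ?_) le_rfl)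
        rw [norm_mul, norm_mul, norm_pow]
    _ ≤ (C₀ * Real.exp (4 * Real.pi * t)) * (t + 1) ^ 2 +
        (C₁ * Real.exp (4 * Real.pi * t)) * (t + 1) ^ 2 +
        (C₂ * Real.exp (4 * Real.pi * t)) * (t + 1) ^ 2 := by
        gcongr
        · refine b₀.trans ?_
          gcongr
          nlinarith
        · refine b₁.trans ?_
          gcongr
          nlinarith
        · exact hnorm.trans (le_self_pow₀ (by linarith) two_ne_zero)
        · refine b₂.trans (le_mul_of_one_le_right (by positivity) ?_)
          exact one_le_pow₀ (by linarith)
    _ = _ := by ring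

theorem norm_exp_pi_mul (r x t : ℝ) :
    ‖cexp (Real.pi * I * (r : ℂ) ^ 2 * (x + I * t))‖ = Real.exp (-(Real.pi * r ^ 2 * t)) := by
  rw [Complex.norm_exp]
  congr 1
  rw [← ofReal_pow]
  simp only [mul_re, ofReal_re, Complex.I_re, mul_zero, ofReal_im, Complex.I_im, mul_one,
    sub_self, zero_mul, mul_im, add_zero, zero_sub, add_re, add_im, zero_add, one_mul]

theorem exists_norm_integrand_le {r : ℝ} (hr : 2 < r) : ∃ K, 0 ≤ K ∧ ∃ δ, 0 < δ ∧
    ∀ t : ℝ, 1 ≤ t → ∀ x : ℝ, |x| ≤ 1 → ‖integrand r (x + I * t)‖ ≤ K * Real.exp (-δ * t) := by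
  obtain ⟨C, hC0, hC⟩ := exists_norm_phiInv_le
  have hr2 : 0 < r ^ 2 - 4 := by nlinarith
  -- Half of the net decay rate `π(r² - 4)`; the other half absorbs the factor `(t + 1)²`.
  set δ := Real.pi * (r ^ 2 - 4) / 2 with hδ
  have hδ0 : 0 < δ := by have := Real.pi_pos; positivity
  refine ⟨C * (2 / δ ^ 2 * Real.exp δ), by positivity, δ, hδ0, fun t ht x hx => ?_⟩
  have h1 : (t + 1) ^ 2 ≤ 2 / δ ^ 2 * Real.exp (δ * (t + 1)) := by
    have := Real.pow_div_factorial_le_exp (δ * (t + 1)) (by positivity) 2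
    rw [div_le_iff₀ (by positivity)] at this
    rw [div_mul_eq_mul_div, le_div_iff₀ (by positivity)]
    norm_num at this
    linarith
  rw [integrand_eq, norm_mul, norm_exp_pi_mul]
  calc ‖phiInv (x + I * t)‖ * Real.exp (-(Real.pi * r ^ 2 * t))
      ≤ (C * (2 / δ ^ 2 * Real.exp (δ * (t + 1))) * Real.exp (4 * Real.pi * t)) *
        Real.exp (-(Real.pi * r ^ 2 * t)) := by
        gcongr
        refine (hC x t hx ht).trans ?_
        gcongr
    _ = C * (2 / δ ^ 2) * (Real.exp (δ * (t + 1)) * Real.exp (4 * Real.pi * t) *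
        Real.exp (-(Real.pi * r ^ 2 * t))) := by ring
    _ = C * (2 / δ ^ 2) * (Real.exp δ * Real.exp (-δ * t)) := by
        rw [← Real.exp_add, ← Real.exp_add, ← Real.exp_add]
        congr 2
        rw [hδ]
        ring
    _ = _ := by ring

/-- The factor `z¹⁰` and the Jacobian `1/w²` combine to `w^{-12}`, the exponent being half the
dimension. -/
theorem integrand_neg_one_div_div_sq (r : ℝ) {w : ℂ} (hw : w ≠ 0) :
    integrand r (-1 / w) / w ^ 2 =
      phi w / w ^ 12 * cexp (Real.pi * I * (r : ℂ) ^ 2 * (-1 / w)) := by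
  have h : -1 / (-1 / w) = w := by field_simp
  rw [integrand, h, div_pow]
  field_simp

theorem exists_norm_integrand_neg_one_div_le (r : ℝ) : ∃ K, 0 ≤ K ∧ ∀ w : ℂ, 1 / 2 ≤ w.im →
    ‖integrand r (-1 / w) / w ^ 2‖ ≤ K * Real.exp (-2 * Real.pi * w.im) := by
  obtain ⟨C, hC0, hC⟩ := exists_norm_phi_div_pow_le 12
  refine ⟨C, hC0, fun w hw => ?_⟩
  have hw' : 0 < w.im := lt_of_lt_of_le (by norm_num) hw
  have hw0 : w ≠ 0 := fun h0 => by simp [h0] at hw'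
  rw [integrand_neg_one_div_div_sq r hw0, norm_mul]
  refine (mul_le_of_le_one_right (norm_nonneg _) ?_).trans (hC w hw)
  rw [Complex.norm_exp, Real.exp_le_one_iff, ← ofReal_pow]
  have := neg_one_div_im_pos hw'
  have h2 : (Real.pi * I * ((r ^ 2 : ℝ) : ℂ) * (-1 / w)).re = -(Real.pi * r ^ 2 * (-1 / w).im) := by
    simp only [mul_re, ofReal_re, Complex.I_re, mul_zero, ofReal_im, Complex.I_im, mul_one,
      sub_self, zero_mul, mul_im, add_zero, zero_sub, zero_add]
  rw [h2, neg_nonpos]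
  have := Real.pi_pos
  positivity

theorem continuousOn_integrand_vertical (r x : ℝ) :
    ContinuousOn (fun t : ℝ => integrand r (x + I * t)) (Ioi 0) := by
  refine (differentiableOn_integrand r).continuousOn.comp (by fun_prop) fun s hs => ?_
  have : 0 < s := hs
  simpa using this

theorem integrableOn_integrand_vertical {r : ℝ} (hr : 2 < r) {x : ℝ} (hx : |x| ≤ 1) :
    IntegrableOn (fun t : ℝ => integrand r (x + I * t) * I) (Ioi 1) := by
  obtain ⟨K, hK0, δ, hδ, hK⟩ := exists_norm_integrand_le hr
  refine Integrable.mono' ((exp_neg_integrableOn_Ioi 1 hδ).const_mul K)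
    ((((continuousOn_integrand_vertical r x).mono (Ioi_subset_Ioi zero_le_one)).mul
      continuousOn_const).aestronglyMeasurable measurableSet_Ioi)
    ((ae_restrict_iff' measurableSet_Ioi).2 (.of_forall fun t ht => ?_))
  rw [norm_mul, Complex.norm_I, mul_one]
  exact hK t (le_of_lt ht) x hx

theorem exists_norm_phiInv_axis_le :
    ∃ C, ∀ t : ℝ, 0 < t → t ≤ 1 → ‖phiInv (I * t)‖ ≤ C := by
  obtain ⟨C, hC0, hC⟩ := exists_norm_phi_le
  refine ⟨C, fun t h0 h1 => ?_⟩
  have ht : (t : ℂ) ≠ 0 := by exact_mod_cast h0.ne'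
  have e : -1 / (I * (t : ℂ)) = I * (t⁻¹ : ℝ) := by
    push_cast
    field_simp
    simp
  have him : (I * ((t⁻¹ : ℝ) : ℂ)).im = t⁻¹ := by rw [I_mul_im, ofReal_re]
  have h1' : 1 ≤ t⁻¹ := (one_le_inv₀ h0).2 h1
  have := hC (I * (t⁻¹ : ℝ)) (by rw [him]; linarith)
  rw [phiInv, e, norm_mul]
  calc _ ≤ C * 1 := by
        refine mul_le_mul (this.trans (mul_le_of_le_one_right hC0 ?_)) ?_ (norm_nonneg _) hC0
        · rw [Real.exp_le_one_iff, him]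
          nlinarith [Real.pi_pos]
        · rw [norm_pow, norm_mul, Complex.norm_I, one_mul, Complex.norm_real,
            Real.norm_of_nonneg h0.le]
          exact pow_le_one₀ h0.le h1
    _ = C := mul_one C

theorem convergesAbsolutely {r : ℝ} (hr : 2 < r) : ConvergesAbsolutely (integrand r) := by
  have h0 : (fun t : ℝ => integrand r (I * t) * I) =
      fun t : ℝ => integrand r (((0 : ℝ) : ℂ) + I * t) * I := by simp
  rw [ConvergesAbsolutely, ← Ioc_union_Ioi_eq_Ioi (zero_le_one (α := ℝ))]
  refine IntegrableOn.union ?_ (by rw [h0]; exact integrableOn_integrand_vertical hr (by simp))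
  obtain ⟨C, hC⟩ := exists_norm_phiInv_axis_le
  have hcont : ContinuousOn (fun t : ℝ => integrand r (I * t) * I) (Ioc 0 1) := by
    rw [h0]
    exact ((continuousOn_integrand_vertical r 0).mono Ioc_subset_Ioi_self).mul continuousOn_const
  refine Integrable.mono' (integrableOn_const (C := C) (by simp))
    (hcont.aestronglyMeasurable measurableSet_Ioc)
    ((ae_restrict_iff' measurableSet_Ioc).2 (.of_forall fun t ht => ?_))
  have h1 := norm_exp_pi_mul r 0 t
  rw [ofReal_zero, zero_add] at h1
  rw [norm_mul, Complex.norm_I, mul_one, integrand_eq, norm_mul, h1]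
  refine (mul_le_of_le_one_right (norm_nonneg _) ?_).trans (hC t ht.1 ht.2)
  rw [Real.exp_le_one_iff, neg_nonpos]
  have := Real.pi_pos
  have := ht.1
  positivity

theorem tendsto_const_mul_exp_neg (K : ℝ) {δ : ℝ} (hδ : 0 < δ) :
    Tendsto (fun T : ℝ => K * Real.exp (-δ * T)) atTop (𝓝 0) := by
  have h : Tendsto (fun T : ℝ => δ * T) atTop atTop := tendsto_id.const_mul_atTop hδ
  simpa [Function.comp_def] using (Real.tendsto_exp_neg_atTop_nhds_zero.comp h).const_mul K

theorem integrableOn_integrand_arc (r ε : ℝ) :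
    IntegrableOn (fun s : ℝ => integrand r (-1 / line ε s) / line ε s ^ 2 * I)
      (Ioi (1 / 2)) := by
  obtain ⟨K, hK0, hK⟩ := exists_norm_integrand_neg_one_div_le r
  have hcont : ContinuousOn (fun s : ℝ => integrand r (-1 / line ε s) / line ε s ^ 2 * I)
      (Ioi (1 / 2)) := by
    have hline := (continuous_line ε).continuousOn (s := Ioi (1 / 2 : ℝ))
    have hne : ∀ s ∈ Ioi (1 / 2 : ℝ), line ε s ≠ 0 := fun s hs =>
      line_ne_zero ε (lt_trans (by norm_num) hs)
    refine ContinuousOn.mul (ContinuousOn.div ?_ (hline.pow 2) fun s hs =>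
      pow_ne_zero 2 (hne s hs)) continuousOn_const
    refine (differentiableOn_integrand r).continuousOn.comp (continuousOn_const.div hline hne)
      fun s hs => neg_one_div_im_pos ?_
    rw [line_im]
    exact lt_trans (by norm_num) hs
  refine Integrable.mono' ((exp_neg_integrableOn_Ioi (1 / 2) Real.two_pi_pos).const_mul K)
    (hcont.aestronglyMeasurable measurableSet_Ioi)
    ((ae_restrict_iff' measurableSet_Ioi).2 (.of_forall fun s hs => ?_))
  have := hK (line ε s) (by rw [line_im]; exact le_of_lt hs)
  rw [line_im] at this
  rw [norm_mul, Complex.norm_I, mul_one]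
  simpa using this

/-! ### The formula for `a` as a sum of four superpositions -/

theorem integral_integrand_arc (r ε : ℝ) :
    cexp (-(Real.pi * I * (r : ℂ) ^ 2 * ε)) *
      ∫ s in Ioi (1 / 2 : ℝ), integrand r (-1 / line ε s) / line ε s ^ 2 * I =
      -superposition (1 / 2) (arcWeight ε) (arcPath ε) 0 ((r ^ 2 : ℝ) : ℂ) := by
  rw [superposition, ← integral_const_mul, ← integral_neg]
  refine setIntegral_congr_fun measurableSet_Ioi fun s hs => ?_
  have hne : line ε s ≠ 0 := line_ne_zero ε (lt_trans (by norm_num) hs)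
  rw [integrand_neg_one_div_div_sq r hne, arcWeight, arcPath, pow_zero, mul_one]
  have he : cexp (Real.pi * I * ((r ^ 2 : ℝ) : ℂ) * (-ε - 1 / line ε s)) =
      cexp (-(Real.pi * I * (r : ℂ) ^ 2 * ε)) *
        cexp (Real.pi * I * (r : ℂ) ^ 2 * (-1 / line ε s)) := by
    rw [← Complex.exp_add]
    congr 1
    push_cast
    ring
  rw [he]
  ring

theorem integrand_add (r ε t : ℝ) :
    cexp (-(Real.pi * I * (r : ℂ) ^ 2 * ε)) * integrand r (ε + I * t) =
      phiInv (ε + I * t) * cexp (Real.pi * I * (r : ℂ) ^ 2 * (I * t)) := by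
  have he : cexp (Real.pi * I * (r : ℂ) ^ 2 * (I * t)) =
      cexp (-(Real.pi * I * (r : ℂ) ^ 2 * ε)) *
        cexp (Real.pi * I * (r : ℂ) ^ 2 * (ε + I * t)) := by
    rw [← Complex.exp_add]
    congr 1
    ring
  rw [integrand_eq, he]
  ring

theorem integrableOn_phiInv {r : ℝ} (hr : 2 < r) {ε : ℝ} (hε : |ε| ≤ 1) :
    IntegrableOn (fun t : ℝ => phiInv (ε + I * t) * cexp (Real.pi * I * (r : ℂ) ^ 2 * (I * t)) * I)
      (Ioi 1) := by
  refine ((integrableOn_integrand_vertical hr hε).const_mul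
    (cexp (-(Real.pi * I * (r : ℂ) ^ 2 * ε)))).congr (.of_forall fun t => ?_)
  beta_reduce
  rw [← integrand_add, ← mul_assoc]

theorem exp_mul_imaginaryAxisIntegral {r : ℝ} (hr : 2 < r) {ε : ℝ} (hε : ε ^ 2 = 1) :
    cexp (-(Real.pi * I * (r : ℂ) ^ 2 * ε)) * imaginaryAxisIntegral (integrand r) =
      (∫ t in Ioi (1 : ℝ), phiInv (ε + I * t) * cexp (Real.pi * I * (r : ℂ) ^ 2 * (I * t)) * I) +
      superposition (1 / 2) (arcWeight ε) (arcPath ε) 0 ((r ^ 2 : ℝ) : ℂ) := by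
  have hε1 : |ε| = 1 := by rw [← Real.sqrt_sq_eq_abs, hε, Real.sqrt_one]
  obtain ⟨K, hK0, δ, hδ, hK⟩ := exists_norm_integrand_le hr
  obtain ⟨K', hK0', hK'⟩ := exists_norm_integrand_neg_one_div_le r
  have h := integral_imaginary_axis_eq (differentiableOn_integrand r) hε
    (tendsto_const_mul_exp_neg K hδ) (tendsto_const_mul_exp_neg K' Real.two_pi_pos) hK
    (fun T hT x _ => by
      have := hK' (x + I * T) (by simp; linarith)
      simpa using this)
    (convergesAbsolutely hr) (integrableOn_integrand_vertical hr hε1.le)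
    (integrableOn_integrand_arc r ε)
  have h2 := integral_integrand_arc r ε
  rw [imaginaryAxisIntegral, h, mul_sub]
  change _ - _ * ∫ s in Ioi (1 / 2 : ℝ), integrand r (-1 / line ε s) / line ε s ^ 2 * I = _
  rw [h2, sub_neg_eq_add, ← integral_const_mul]
  congr 2
  ext t
  rw [← integrand_add, ← mul_assoc]

/-- Splitting at `i`, the lower part becomes an integral over `s > 1` under `t = 1/s`; the sign
comes from `i¹⁰ = -1`. -/
theorem imaginaryAxisIntegral_eq {r : ℝ} (hr : 2 < r) :
    imaginaryAxisIntegral (integrand r) =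
      (∫ t in Ioi (1 : ℝ), phiInv (I * t) * cexp (Real.pi * I * (r : ℂ) ^ 2 * (I * t)) * I) -
      1 / 2 * superposition 1 invAxisWeight invAxisPath 0 ((r ^ 2 : ℝ) : ℂ) := by
  have himage : (fun s : ℝ => s⁻¹) '' Ioi 1 = Ioo 0 1 := by
    ext t
    constructor
    · rintro ⟨s, hs, rfl⟩
      have : (1 : ℝ) < s := hs
      exact ⟨by positivity, inv_lt_one_of_one_lt₀ hs⟩
    · rintro ⟨h0, h1⟩
      exact ⟨t⁻¹, (one_lt_inv₀ h0).2 h1, inv_inv t⟩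
  have hsub := integral_image_eq_integral_abs_deriv_smul (s := Ioi (1 : ℝ)) measurableSet_Ioi
    (f := fun s : ℝ => s⁻¹) (f' := fun s => -(s ^ 2)⁻¹)
    (fun s hs => (hasDerivAt_inv (lt_trans one_pos hs).ne').hasDerivWithinAt)
    (inv_injective.injOn) (fun t : ℝ => integrand r (I * t) * I)
  have hconv := convergesAbsolutely hr
  rw [ConvergesAbsolutely, ← Ioc_union_Ioi_eq_Ioi (zero_le_one (α := ℝ))] at hconv
  rw [imaginaryAxisIntegral, ← Ioc_union_Ioi_eq_Ioi (zero_le_one (α := ℝ)),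
    setIntegral_union (Ioc_disjoint_Ioi le_rfl) measurableSet_Ioi
      (hconv.mono_set subset_union_left) (hconv.mono_set subset_union_right),
    integral_Ioc_eq_integral_Ioo, ← himage, hsub, add_comm, sub_eq_add_neg]
  congr 1
  rw [superposition, ← integral_const_mul, ← integral_neg]
  refine setIntegral_congr_fun measurableSet_Ioi fun s hs => ?_
  have hs0 : (0 : ℝ) < s := lt_trans one_pos hs
  have hsc : (s : ℂ) ≠ 0 := by exact_mod_cast hs0.ne'
  have e : -1 / (I * ((s⁻¹ : ℝ) : ℂ)) = I * s := by
    push_cast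
    field_simp
    simp
  rw [integrand, e, abs_neg, abs_of_pos (by positivity), pow_zero, mul_one, invAxisWeight,
    invAxisPath, real_smul]
  push_cast
  rw [show I * (s : ℂ)⁻¹ = I / s by rw [div_eq_mul_inv], div_pow,
    show I ^ 10 = -1 by rw [show 10 = 2 * 5 by norm_num, pow_mul, I_sq]; norm_num]
  field_simp

/-- With periodic coefficients, the second difference kills the constant and linear terms in `z` and
turns `z²` into `2`. This removes the growing functions `φ₁` and `φ₂`. -/
theorem phiInv_second_difference {z : ℂ} (hz : 0 < z.im) :
    phiInv (1 + z) + phiInv (-1 + z) - 2 * phiInv z = 2 * phi z := by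
  have hm : ∀ {f : ℂ → ℂ}, (∀ z, f (z + 1) = f z) → f (-1 + z) = f z := fun {f} hf => by
    rw [← hf (-1 + z)]
    congr 1
    ring
  rw [phiInv, phiInv, phiInv, phi_neg_one_div_mul hz, phi_neg_one_div_mul (by simpa using hz),
    phi_neg_one_div_mul (by simpa using hz), hm phi_add_one, hm phiOne_add_one, hm phiTwo_add_one,
    add_comm 1 z, phi_add_one, phiOne_add_one, phiTwo_add_one]
  ring

/-- The analytic continuation of `a`, as a function of `u = r²`. -/
noncomputable def continuation (u : ℂ) : ℂ :=
  (superposition (1 / 2) (arcWeight 1) (arcPath 1) 0 u +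
    superposition (1 / 2) (arcWeight (-1)) (arcPath (-1)) 0 u) +
  (superposition 1 invAxisWeight invAxisPath 0 u + superposition 1 axisWeight axisPath 0 u)

theorem neg_four_mul_sin_sq (x : ℝ) : -4 * (Real.sin (x / 2) : ℂ) ^ 2 =
    cexp (-(I * x)) + cexp (I * x) - 2 := by
  have h : (Real.sin (x / 2) : ℂ) ^ 2 = (1 - Complex.cos x) / 2 := by
    have := Complex.cos_sq ((x : ℂ) / 2)
    rw [mul_div_cancel₀ (x : ℂ) two_ne_zero] at this
    have h2 := Complex.sin_sq_add_cos_sq ((x : ℂ) / 2)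
    push_cast
    rw [this] at h2
    linear_combination h2
  rw [h, Complex.cos]
  ring_nf

theorem a_eq {r : ℝ} (hr : 2 < r) : a r = continuation ((r ^ 2 : ℝ) : ℂ) := by
  have h1 := exp_mul_imaginaryAxisIntegral hr (ε := 1) (by norm_num)
  have h2 := exp_mul_imaginaryAxisIntegral hr (ε := -1) (by norm_num)
  have h3 := imaginaryAxisIntegral_eq hr
  have i1 := integrableOn_phiInv hr (ε := 1) (by simp)
  have i2 := integrableOn_phiInv hr (ε := -1) (by simp)
  have i3 := integrableOn_phiInv hr (ε := 0) (by simp)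
  -- The three rays converge separately only because `r > 2`; their combination is the axis
  -- superposition, which makes sense without that restriction.
  have h4 : (∫ t in Ioi (1 : ℝ), phiInv ((1 : ℝ) + I * t) *
        cexp (Real.pi * I * (r : ℂ) ^ 2 * (I * t)) * I) +
      (∫ t in Ioi (1 : ℝ), phiInv ((-1 : ℝ) + I * t) *
        cexp (Real.pi * I * (r : ℂ) ^ 2 * (I * t)) * I) -
      2 * (∫ t in Ioi (1 : ℝ), phiInv (I * t) * cexp (Real.pi * I * (r : ℂ) ^ 2 * (I * t)) * I) =
      superposition 1 axisWeight axisPath 0 ((r ^ 2 : ℝ) : ℂ) := by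
    rw [ofReal_zero] at i3
    simp only [zero_add] at i3
    have hsub := integral_sub (i1.add i2) (i3.const_mul 2)
    simp only [Pi.add_apply] at hsub
    rw [← integral_const_mul, ← integral_add i1 i2, ← hsub, superposition]
    refine setIntegral_congr_fun measurableSet_Ioi fun t ht => ?_
    have ht0 : (0 : ℝ) < t := lt_trans one_pos ht
    have := phiInv_second_difference (z := I * t) (by simpa using ht0)
    rw [axisWeight, axisPath, pow_zero, mul_one]
    push_cast
    linear_combination (cexp (Real.pi * I * (r : ℂ) ^ 2 * (I * t)) * I) * this
  have hsin : -4 * (Real.sin (Real.pi * r ^ 2 / 2) : ℂ) ^ 2 =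
      cexp (-(Real.pi * I * (r : ℂ) ^ 2 * (1 : ℝ))) +
      cexp (-(Real.pi * I * (r : ℂ) ^ 2 * (-1 : ℝ))) - 2 := by
    rw [neg_four_mul_sin_sq]
    push_cast
    congr 3 <;> ring
  rw [a, hsin, continuation, ← h4]
  linear_combination h1 + h2 - 2 * h3

/-! ### Nonvanishing -/

theorem nome_sq_axis (t : ℝ) : nome (I * t) ^ 2 = (Real.exp (-(4 * Real.pi * t)) : ℂ) := by
  rw [nome, ← Complex.exp_nat_mul, ofReal_exp]
  congr 1
  push_cast
  linear_combination (4 * Real.pi * t : ℂ) * I_sq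

theorem tendsto_phiInv_axis :
    Tendsto (fun t : ℝ => phiInv (I * t) * nome (I * t) ^ 2) atTop
      (𝓝 ((864 / Real.pi ^ 2 : ℝ) : ℂ)) := by
  have hpi := Real.pi_gt_three
  have hbound : ∀ (n : ℕ) (f : ℂ → ℂ), (∃ C, 0 ≤ C ∧ ∀ z : ℂ, 1 / 2 ≤ z.im →
      ‖f z‖ ≤ C * Real.exp (2 * Real.pi * z.im)) →
      Tendsto (fun t : ℝ => f (I * t) * (I * t) ^ n * nome (I * t) ^ 2) atTop (𝓝 0) := by
    rintro n f ⟨C, hC0, hC⟩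
    have h0 := (Real.tendsto_pow_mul_exp_neg_atTop_nhds_zero n).const_mul C
    rw [mul_zero] at h0
    refine squeeze_zero_norm' ?_ h0
    filter_upwards [eventually_ge_atTop 1] with t ht
    have him : (I * (t : ℂ)).im = t := by simp
    have := hC (I * t) (by rw [him]; linarith)
    rw [him] at this
    rw [nome_sq_axis, norm_mul, norm_mul, norm_pow, norm_mul, Complex.norm_I, one_mul,
      Complex.norm_real, Complex.norm_real, Real.norm_of_nonneg (by linarith),
      Real.norm_of_nonneg (Real.exp_pos _).le]
    calc _ ≤ (C * Real.exp (2 * Real.pi * t)) * t ^ n * Real.exp (-(4 * Real.pi * t)) := by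
          gcongr
      _ = C * (t ^ n * (Real.exp (2 * Real.pi * t) * Real.exp (-(4 * Real.pi * t)))) := by ring
      _ ≤ _ := by
          rw [← Real.exp_add]
          gcongr
          nlinarith
  have h1 := hbound 2 phi (by
    obtain ⟨C, hC0, hC⟩ := exists_norm_phi_le
    refine ⟨C, hC0, fun z hz => (hC z hz).trans ?_⟩
    gcongr
    nlinarith)
  have h2 := hbound 1 phiOne exists_norm_phiOne_le
  have h3 := (h1.add h2).add tendsto_phiTwo_mul_nome_sq
  rw [zero_add, zero_add] at h3
  refine h3.congr' ?_
  filter_upwards [eventually_gt_atTop 0] with t ht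
  rw [phiInv, phi_neg_one_div_mul (by simpa using ht)]
  ring

/-- Any constant strictly between `0` and the limit `864/π²` would do in place of `1/π²`. -/
theorem exists_le_re_phiInv : ∃ T : ℝ, 1 ≤ T ∧ ∀ t, T < t →
    1 / Real.pi ^ 2 * Real.exp (4 * Real.pi * t) ≤ (phiInv (I * t)).re := by
  have h := (Complex.continuous_re.tendsto _).comp tendsto_phiInv_axis
  rw [ofReal_re] at h
  have hlt : 1 / Real.pi ^ 2 < 864 / Real.pi ^ 2 := by
    gcongr
    norm_num
  obtain ⟨T, hT⟩ := eventually_atTop.1 (h.eventually (lt_mem_nhds hlt))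
  refine ⟨max T 1, le_max_right _ _, fun t ht => ?_⟩
  have := hT t ((le_max_left _ _).trans ht.le)
  simp only [Function.comp_apply, nome_sq_axis, re_mul_ofReal] at this
  have h2 := mul_le_mul_of_nonneg_right this.le (Real.exp_pos (4 * Real.pi * t)).le
  rwa [mul_assoc (phiInv (I * t)).re, ← Real.exp_add, neg_add_cancel, Real.exp_zero,
    mul_one] at h2

theorem exists_norm_phiInv_Ioc_le (T : ℝ) : ∃ M, ∀ t ∈ Ioc 0 T, ‖phiInv (I * t)‖ ≤ M := by
  obtain ⟨C, hC⟩ := exists_norm_phiInv_axis_le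
  obtain ⟨C', hC0', hC'⟩ := exists_norm_phiInv_le
  refine ⟨max C (C' * (T + 1) ^ 2 * Real.exp (4 * Real.pi * T)), fun t ht => ?_⟩
  rcases le_total t 1 with h | h
  · exact (hC t ht.1 h).trans (le_max_left _ _)
  · have := hC' 0 t (by simp) h
    rw [ofReal_zero, zero_add] at this
    refine (this.trans ?_).trans (le_max_right _ _)
    have := Real.pi_pos
    have h1 := ht.1
    have h2 := ht.2
    gcongr

theorem integral_re_phiInv_eq_zero {r : ℝ} (hr : 2 < r)
    (h : imaginaryAxisIntegral (integrand r) = 0) :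
    IntegrableOn (fun t : ℝ => (phiInv (I * t)).re * Real.exp (-(Real.pi * r ^ 2 * t))) (Ioi 0) ∧
    ∫ t in Ioi (0 : ℝ), (phiInv (I * t)).re * Real.exp (-(Real.pi * r ^ 2 * t)) = 0 := by
  have hconv := convergesAbsolutely hr
  have heq : ∀ t : ℝ, (integrand r (I * t)) = phiInv (I * t) *
      (Real.exp (-(Real.pi * r ^ 2 * t)) : ℂ) := fun t => by
    rw [integrand_eq, ofReal_exp]
    congr 2
    push_cast
    linear_combination (Real.pi * (r : ℂ) ^ 2 * t) * I_sq
  have hint : Integrable (fun t : ℝ => integrand r (I * t)) (volume.restrict (Ioi 0)) := by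
    refine (hconv.mul_const (-I)).congr (.of_forall fun t => ?_)
    beta_reduce
    rw [mul_assoc, mul_neg, I_mul_I, neg_neg, mul_one]
  have hzero : ∫ t in Ioi (0 : ℝ), integrand r (I * t) = 0 := by
    rw [imaginaryAxisIntegral, integral_mul_const] at h
    exact (mul_eq_zero.1 h).resolve_right I_ne_zero
  have hre : ∀ t : ℝ, (phiInv (I * t)).re * Real.exp (-(Real.pi * r ^ 2 * t)) =
      RCLike.re (integrand r (I * t)) := fun t => by
    rw [heq]
    exact (re_mul_ofReal _ _).symm
  constructor
  · exact hint.re.congr (.of_forall fun t => (hre t).symm)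
  · simp only [hre]
    rw [integral_re hint, hzero]
    simp

theorem exists_a_ne_zero : ∃ r : ℝ, 2 < r ∧ a r ≠ 0 := by
  by_contra! hall
  obtain ⟨T, hT1, hT⟩ := exists_le_re_phiInv
  obtain ⟨M, hM⟩ := exists_norm_phiInv_Ioc_le T
  have hpi := Real.pi_pos
  -- Take `r² = 4 + κ`, so that the sine factor is nonzero and the integral itself must vanish. Its
  -- part over `(0, T]` is at most `M T` in modulus, while the tail is at least a multiple of `∫_T^∞
  -- e^{-πκt} dt`, of order `1/κ`.
  have key : ∀ κ ∈ Ioo (0 : ℝ) 1, 1 / Real.pi ^ 2 * Real.exp (-(Real.pi * κ) * T) ≤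
      Real.pi * κ * (M * T) := by
    rintro κ ⟨hκ0, hκ1⟩
    have hr2 : Real.sqrt (4 + κ) ^ 2 = 4 + κ := Real.sq_sqrt (by linarith)
    have hr : 2 < Real.sqrt (4 + κ) := Real.lt_sqrt_of_sq_lt (by linarith)
    have hsin : Real.sin (Real.pi * Real.sqrt (4 + κ) ^ 2 / 2) ≠ 0 := by
      rw [hr2, show Real.pi * (4 + κ) / 2 = Real.pi * κ / 2 + 2 * Real.pi by ring,
        Real.sin_add_two_pi]
      exact (Real.sin_pos_of_pos_of_lt_pi (by positivity) (by nlinarith)).ne'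
    have hI : imaginaryAxisIntegral (integrand (Real.sqrt (4 + κ))) = 0 := by
      have := hall _ hr
      rw [a] at this
      refine (mul_eq_zero.1 this).resolve_left (mul_ne_zero (by norm_num) (pow_ne_zero 2 ?_))
      exact_mod_cast hsin
    obtain ⟨hint, hzero⟩ := integral_re_phiInv_eq_zero hr hI
    rw [hr2] at hint hzero
    have hT0 : (0 : ℝ) ≤ T := by linarith
    rw [← Ioc_union_Ioi_eq_Ioi hT0] at hint hzero
    rw [setIntegral_union (Ioc_disjoint_Ioi le_rfl) measurableSet_Ioi
      (hint.mono_set subset_union_left) (hint.mono_set subset_union_right)] at hzero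
    have hlow : |∫ t in Ioc 0 T, (phiInv (I * t)).re * Real.exp (-(Real.pi * (4 + κ) * t))| ≤
        M * T := by
      have := norm_setIntegral_le_of_norm_le_const (C := M) (μ := volume) (s := Ioc 0 T)
        (f := fun t : ℝ => (phiInv (I * t)).re * Real.exp (-(Real.pi * (4 + κ) * t)))
        (by simp) (fun t ht => by
          rw [norm_mul, Real.norm_eq_abs, Real.norm_of_nonneg (Real.exp_pos _).le]
          refine (mul_le_of_le_one_right (abs_nonneg _) ?_).trans
            ((Complex.abs_re_le_norm _).trans (hM t ht))
          rw [Real.exp_le_one_iff, neg_nonpos]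
          have := ht.1
          positivity)
      simpa [hT0] using this
    have hneg : -(Real.pi * κ) < 0 := by rw [neg_lt_zero]; positivity
    have hhigh : 1 / Real.pi ^ 2 * (Real.exp (-(Real.pi * κ) * T) / (Real.pi * κ)) ≤
        ∫ t in Ioi T, (phiInv (I * t)).re * Real.exp (-(Real.pi * (4 + κ) * t)) := by
      have hexp := integral_exp_mul_Ioi hneg T
      rw [neg_div_neg_eq] at hexp
      rw [← hexp, ← integral_const_mul]
      refine setIntegral_mono_on ((integrableOn_exp_mul_Ioi hneg T).const_mul _)
        (hint.mono_set subset_union_right) measurableSet_Ioi fun t ht => ?_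
      calc 1 / Real.pi ^ 2 * Real.exp (-(Real.pi * κ) * t)
          = (1 / Real.pi ^ 2 * Real.exp (4 * Real.pi * t)) *
            Real.exp (-(Real.pi * (4 + κ) * t)) := by
            rw [mul_assoc, ← Real.exp_add]
            ring_nf
        _ ≤ _ := by
            gcongr
            exact hT t ht
    have hle : 1 / Real.pi ^ 2 * (Real.exp (-(Real.pi * κ) * T) / (Real.pi * κ)) ≤ M * T := by
      have := neg_le_abs
        (∫ t in Ioc 0 T, (phiInv (I * t)).re * Real.exp (-(Real.pi * (4 + κ) * t)))
      linarith
    rw [← mul_div_assoc, div_le_iff₀ (by positivity)] at hle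
    linarith
  have hlim₁ : Tendsto (fun κ : ℝ => 1 / Real.pi ^ 2 * Real.exp (-(Real.pi * κ) * T)) (𝓝[>] 0)
      (𝓝 (1 / Real.pi ^ 2)) := by
    have : Continuous fun κ : ℝ => 1 / Real.pi ^ 2 * Real.exp (-(Real.pi * κ) * T) := by fun_prop
    simpa using (this.tendsto 0).mono_left nhdsWithin_le_nhds
  have hlim₂ : Tendsto (fun κ : ℝ => Real.pi * κ * (M * T)) (𝓝[>] 0) (𝓝 0) := by
    have : Continuous fun κ : ℝ => Real.pi * κ * (M * T) := by fun_prop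
    simpa using (this.tendsto 0).mono_left nhdsWithin_le_nhds
  -- Letting `κ → 0⁺` yields `1/π² ≤ 0`, a contradiction.
  have hle := le_of_tendsto_of_tendsto hlim₁ hlim₂
    (by filter_upwards [Ioo_mem_nhdsGT one_pos] with κ hκ using key κ hκ)
  have : 0 < 1 / Real.pi ^ 2 := by positivity
  linarith

/-! ### Holomorphy, the Schwartz property and the eigenfunction equation -/

theorem differentiableAt_continuation {u : ℂ} (hu : -1 < u.re) :
    DifferentiableAt ℂ continuation u :=
  (((isGaussianPath_arc (by norm_num)).hasDerivAt 0 hu).differentiableAt.add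
    ((isGaussianPath_arc (by norm_num)).hasDerivAt 0 hu).differentiableAt).add
  ((isGaussianPath_invAxis.hasDerivAt 0 hu).differentiableAt.add
    (isGaussianPath_axis.hasDerivAt 0 hu).differentiableAt)

theorem exists_schwartz_continuation (E : Type*) [NormedAddCommGroup E] [InnerProductSpace ℝ E] :
    ∃ f : 𝓢(E, ℂ), ∀ x, f x = continuation ((‖x‖ ^ 2 : ℝ) : ℂ) := by
  obtain ⟨f₁, h₁⟩ := (isGaussianPath_arc (ε := 1) (by norm_num)).exists_schwartz E
  obtain ⟨f₂, h₂⟩ := (isGaussianPath_arc (ε := -1) (by norm_num)).exists_schwartz E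
  obtain ⟨f₃, h₃⟩ := isGaussianPath_invAxis.exists_schwartz E
  obtain ⟨f₄, h₄⟩ := isGaussianPath_axis.exists_schwartz E
  exact ⟨f₁ + f₂ + (f₃ + f₄), fun x => by
    simp only [add_apply, h₁, h₂, h₃, h₄, continuation]⟩

theorem exists_schwartz_fourier_eq_self :
    ∃ f : 𝓢(EuclideanSpace ℝ (Fin 24), ℂ),
      (∀ x, f x = continuation ((‖x‖ ^ 2 : ℝ) : ℂ)) ∧ 𝓕 f = f := by
  obtain ⟨f₁, h₁⟩ := (isGaussianPath_arc (ε := 1) (by norm_num)).exists_schwartz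
    (EuclideanSpace ℝ (Fin 24))
  obtain ⟨f₂, h₂⟩ := (isGaussianPath_arc (ε := -1) (by norm_num)).exists_schwartz
    (EuclideanSpace ℝ (Fin 24))
  obtain ⟨f₃, h₃⟩ := isGaussianPath_invAxis.exists_schwartz (EuclideanSpace ℝ (Fin 24))
  obtain ⟨f₄, h₄⟩ := isGaussianPath_axis.exists_schwartz (EuclideanSpace ℝ (Fin 24))
  have F₁ : 𝓕 f₁ = f₂ := by
    ext w
    rw [SchwartzMap.fourier_coe, funext h₁, fourier_arc (by norm_num), h₂]
  have F₂ : 𝓕 f₂ = f₁ := by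
    ext w
    rw [SchwartzMap.fourier_coe, funext h₂, fourier_arc (by norm_num), h₁, neg_neg]
  have F₃ : 𝓕 f₃ = f₄ := by
    ext w
    rw [SchwartzMap.fourier_coe, funext h₃, fourier_invAxis, h₄]
  have F₄ : 𝓕 f₄ = f₃ := by
    ext w
    rw [SchwartzMap.fourier_coe, funext h₄, fourier_axis, h₃]
  refine ⟨f₁ + f₂ + (f₃ + f₄), fun x => ?_, ?_⟩
  · simp only [add_apply, h₁, h₂, h₃, h₄, continuation]
  · rw [FourierTransform.fourier_add, FourierTransform.fourier_add, FourierTransform.fourier_add,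
      F₁, F₂, F₃, F₄, add_comm f₂, add_comm f₄]

end PlusOneEigenfunction

theorem lemma2 :
    (∀ r : ℝ, 2 < r →
      PlusOneEigenfunction.ConvergesAbsolutely (PlusOneEigenfunction.integrand r)) ∧
    ∃ (U : Set ℂ) (A : ℂ → ℂ),
      IsOpen U ∧ IsConnected U ∧ (∀ x : ℝ, (x : ℂ) ∈ U) ∧
      DifferentiableOn ℂ A U ∧
      (∀ r : ℝ, 2 < r → A (r : ℂ) = PlusOneEigenfunction.a r) ∧
      (∃ g : 𝓢(ℝ, ℂ), ∀ r : ℝ, g r = A (r : ℂ)) ∧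
      (∃ f : 𝓢(EuclideanSpace ℝ (Fin 24), ℂ),
        (∀ x : EuclideanSpace ℝ (Fin 24), f x = A ((‖x‖ : ℝ) : ℂ)) ∧
        f ≠ 0 ∧ 𝓕 f = f) := by
  -- On the strip `|Im z| < 1` one has `Re z² > -1`, the half plane where the continuation in `u =
  -- z²` is holomorphic.
  refine ⟨fun r hr => PlusOneEigenfunction.convergesAbsolutely hr, {z : ℂ | z.im ∈ Ioo (-1) 1},
    fun z => PlusOneEigenfunction.continuation (z ^ 2), isOpen_Ioo.preimage Complex.continuous_im,
    ⟨⟨0, by simp⟩, ((convex_Ioo (-1 : ℝ) 1).linear_preimage Complex.imLm).isPreconnected⟩,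
    fun x => by simp, fun z hz => ?_, fun r hr => ?_, ?_, ?_⟩
  · have hre : -1 < (z ^ 2).re := by
      have h1 : -1 < z.im := hz.1
      have h2 : z.im < 1 := hz.2
      rw [sq, Complex.mul_re]
      nlinarith [sq_nonneg z.re]
    exact (DifferentiableAt.comp (g := PlusOneEigenfunction.continuation) (f := fun z : ℂ => z ^ 2) z
      (PlusOneEigenfunction.differentiableAt_continuation hre)
      (by fun_prop)).differentiableWithinAt
  · rw [PlusOneEigenfunction.a_eq hr, ofReal_pow]
  · obtain ⟨g, hg⟩ := PlusOneEigenfunction.exists_schwartz_continuation ℝ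
    refine ⟨g, fun r => ?_⟩
    rw [hg, Real.norm_eq_abs, sq_abs, ofReal_pow]
  · obtain ⟨f, hf, hF⟩ := PlusOneEigenfunction.exists_schwartz_fourier_eq_self
    refine ⟨f, fun x => by rw [hf, ofReal_pow], fun h0 => ?_, hF⟩
    obtain ⟨r, hr, hne⟩ := PlusOneEigenfunction.exists_a_ne_zero
    refine hne ?_
    -- A vector of norm `r` at which the radial function takes the nonzero value `a r`.
    have h := hf (EuclideanSpace.single 0 r)
    rw [h0, PiLp.norm_single, Real.norm_eq_abs, sq_abs] at h
    rw [PlusOneEigenfunction.a_eq hr, ← h, zero_apply]
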